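/- Let $\mathbb K$ be the field of Hahn series $c=\sum_{\gamma\in\mathbb R}c_\gamma t^\gamma$ with $c_\gamma\in\mathbb C$, in which every nonempty set of exponents occurring in $c$ has a largest element; let $\nu(c)$ be the largest exponent occurring in $c\neq 0$, let $\nu(0)=-\infty$, and write $c=\hat c\,t^{\nu(c)}+o(t^{\nu(c)})$ with $\hat c\in\mathbb C^*$. The associated graded ring is $\mathrm{gr}_\nu(\mathbb K)=\mathbb C[t^{\mathbb R}]$, and $\mathrm{in}_\nu(c)=\hat c\,t^{\nu(c)}$ for $c\ne0$. For a nonzero polynomial $f=\sum_{u}c_ux^u\in\mathbb K[x_1,\dots,x_4]$ and $\alpha\in\mathbb R$ put $$\mathrm{Trop}(f)\cdot\alpha=\max\{\nu(c_u)+\alpha|u| : c_u\neq 0\},\qquad \mathrm{IN}_{\underline\alpha}(f)=\sum_{\nu(c_u)+\alpha|u|=\mathrm{Trop}(f)\cdot\alpha}\mathrm{in}_\nu(c_u)X^u ,$$ and $\mathrm{IN}_{\underline\alpha}(0)=0$. The tropical roots of $\mathrm{Trop}(f)$ are the values $\alpha$ at which the graph of the piecewise affine function $\alpha\mapsto\mathrm{Trop}(f)\cdot\alpha$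 bends. For an ideal $I\subset\mathbb K[x_1,\dots,x_4]$ let $\mathrm{IN}_{\underline\alpha}(I)\subset\mathrm{gr}_\nu(\mathbb K)[X_1,\dots,X_4]$ be the ideal generated by the $\mathrm{IN}_{\underline\alpha}(f)$, $f\in I$. A real number $\beta$ is a critical level of $I$ unless $\mathrm{IN}_{\underline\alpha}(I)$ is constant and homogeneous in $X$ for $\alpha$ in an open interval around $\beta$; the critical levels of an algebraic set $X\subset\mathbb K^4$ are those of its vanishing ideal. For $z\in\mathbb K^4\setminus\{0\}$ let $\mathrm{In}_\nu(z)=(\alpha,\theta)\in\mathbb R\times\mathbb C^4$, where $\alpha=\max_i\nu(z_i)$ and $z=\theta t^\alpha+o(t^\alpha)$. For $X\subset\mathbb K^4$ put $\mathrm{In}_\nu(X)=\{\mathrm{In}_\nu(z):z\in X\setminus\{0\}\}$ and let $\mathrm{In}_\nu(X)_\alpha=\{\theta:(\alpha,\theta)\in\mathrm{In}_\nu(X)\}$ be its level-$\alpha$ part. Identify $\mathbb K^4$ with the $2\times2$ matrices over $\mathbb K$, and let $\det=x_1x_4-x_2x_3$. **Statement.** For every finite nonempty set $U\subset\mathbb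 N^4$ there is a nonzero polynomial $P$ with complex coefficients in variables indexed by $U$, depending only on $U$, such that the following holds for every $f=\sum_{u\in U}c_ux^u\in\mathbb K[x_1,\dots,x_4]$ with all $c_u\neq0$ (and arbitrary $\nu(c_u)$) and with $P((\hat c_u)_{u\in U})\neq0$. Suppose that the ideal $\langle\det-1,f\rangle$ is prime, and let $X\subset\mathrm{SL}_2(\mathbb K)$ be the irreducible surface that it defines. Then 1. the positive critical levels of $X$ are exactly the positive tropical roots of $\mathrm{Trop}(f)$; 2. for every $\alpha>0$, $$\mathrm{In}_\nu(X)_\alpha=\mathbb V(\det,\mathrm{IN}_{\underline\alpha}(f))\setminus\{0\} =\{\theta\in\mathbb C^4\setminus\{0\}:\det(\theta)=0,\ \mathrm{IN}_{\underline\alpha}(f)(t^\alpha\theta)=0\}.$$ -/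

import Mathlib

open scoped Topology

noncomputable section

namespace PhaseTrop

/-- The field `𝕂` of Hahn series with complex coefficients and real exponents. Mathlib's series have
well-ordered supports in a variable `T`; the variable `t` of the `(max, +)` convention is `T⁻¹`, so
that `t ^ γ` is `single (-γ) 1`. -/
abbrev HahnK : Type := HahnSeries ℝ ℂ

/-- The graded algebra `gr_ν(𝕂)`, which is the group algebra `ℂ[ℝ]`; its homogeneous part `g_α` of
degree `α` is `ℂ · [α]`. -/
abbrev GrK : Type := AddMonoidAlgebra ℂ ℝ

open Classical in
/-- The valuation in the `(max, +)` convention: `ν(c)` is the largest exponent of `t` in `c`,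
and `ν(0) = -∞`. -/
def nu (c : HahnK) : WithBot ℝ :=
  if c = 0 then ⊥ else ((-c.order : ℝ) : WithBot ℝ)

/-- The initial form `in_ν(c) = ĉ · [ν(c)]` where `c = ĉ t^{ν(c)} + o(t^{ν(c)})`; `in_ν(0) = 0`. -/
def initForm (c : HahnK) : GrK :=
  AddMonoidAlgebra.single ((nu c).unbotD 0) c.leadingCoeff

/-- `ν(c_u) + α |u|`, the value of the term `c_u x^u` of `f` when all variables have weight `α`. -/
def termVal (f : MvPolynomial (Fin 4) HahnK) (α : ℝ) (u : Fin 4 →₀ ℕ) : WithBot ℝ :=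
  nu (f.coeff u) + ((α * (u.degree : ℝ) : ℝ) : WithBot ℝ)

/-- `Trop(f) · α = max {ν(c_u) + α |u| : c_u ≠ 0}`. It is also the value at `f` of the monomial
valuation with weights `(α, …, α)`. -/
def trop (f : MvPolynomial (Fin 4) HahnK) (α : ℝ) : WithBot ℝ :=
  f.support.sup (termVal f α)

/-- `β` is a tropical root of `Trop(f)`, i.e. the first coordinate of a bend of the graph of the
piecewise affine function `α ↦ Trop(f) · α`: this function is not affine near `β`. -/
def IsTropicalRoot (f : MvPolynomial (Fin 4) HahnK) (β : ℝ) : Prop :=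
  f ≠ 0 ∧ ¬ ∃ m b : ℝ, ∀ᶠ α in 𝓝 β, trop f α = ((m * α + b : ℝ) : WithBot ℝ)

open Classical in
/-- `IN_α(f) = ∑ in_ν(c_u) X^u` over those `u` in the support of `f` for which
`ν(c_u) + α |u|` is maximal. -/
def initPoly (α : ℝ) (f : MvPolynomial (Fin 4) HahnK) : MvPolynomial (Fin 4) GrK :=
  ∑ u ∈ f.support with termVal f α u = trop f α,
    MvPolynomial.monomial u (initForm (f.coeff u))

/-- The initial ideal `IN_α(I)`, generated by the `IN_α(f)` with `f ∈ I`. -/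
def initIdeal (α : ℝ) (I : Ideal (MvPolynomial (Fin 4) HahnK)) :
    Ideal (MvPolynomial (Fin 4) GrK) :=
  Ideal.span (initPoly α '' (I : Set (MvPolynomial (Fin 4) HahnK)))

/-- An ideal of `gr_ν(𝕂)[X]` is homogeneous (for the total degree in `X`) if it contains the
homogeneous components of its elements. -/
def IsHomogeneousIdeal (J : Ideal (MvPolynomial (Fin 4) GrK)) : Prop :=
  ∀ F ∈ J, ∀ n : ℕ, MvPolynomial.homogeneousComponent n F ∈ J

/-- `β` is a critical level of `I`. The critical levels form the smallest finite set of reals such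
that, on every open interval that does not meet it, the initial ideal `IN_α(I)` is constant and
homogeneous. Hence `β` is *not* critical exactly when
`IN_α(I)` is constant and homogeneous on an open interval around `β`. -/
def IsCriticalLevel (I : Ideal (MvPolynomial (Fin 4) HahnK)) (β : ℝ) : Prop :=
  ¬ ∃ ε : ℝ, 0 < ε ∧ ∀ α ∈ Set.Ioo (β - ε) (β + ε),
      initIdeal α I = initIdeal β I ∧
      IsHomogeneousIdeal (initIdeal α I)

/-- The determinant of the generic `2 × 2` matrix `(x₀, x₁; x₂, x₃)`. -/
def detPoly (R : Type) [CommRing R] : MvPolynomial (Fin 4) R :=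
  Matrix.det !![MvPolynomial.X 0, MvPolynomial.X 1; MvPolynomial.X 2, MvPolynomial.X 3]

/-- The ideal generated by `det - 1` and one more equation `f`. -/
def surfaceIdeal (f : MvPolynomial (Fin 4) HahnK) : Ideal (MvPolynomial (Fin 4) HahnK) :=
  Ideal.span {detPoly HahnK - 1, f}

/-- The algebraic subset of `SL₂(𝕂) ⊆ 𝕂⁴` cut out by `det - 1` and `f`. -/
def surface (f : MvPolynomial (Fin 4) HahnK) : Set (Fin 4 → HahnK) :=
  MvPolynomial.zeroLocus HahnK (surfaceIdeal f)

/-- `V_ν(z) = max_i ν(z_i)`. -/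
def maxVal (z : Fin 4 → HahnK) : WithBot ℝ :=
  Finset.univ.sup fun i => nu (z i)

/-- The initial form `In_ν(z) = (α, θ)` of a vector `z ≠ 0`, in the phase space
`Gr_ν(𝕂⁴) = ℝ × ℂ⁴`. Here `α = V_ν(z)`, and `θ` is the vector of the coefficients of `t^α`
in the entries of `z`: `θ_i` is the leading coefficient of `z_i` if `ν(z_i) = α`,
and `0` if `ν(z_i) < α`. -/
def phase (z : Fin 4 → HahnK) : ℝ × (Fin 4 → ℂ) :=
  ((maxVal z).unbotD 0, fun i => (z i).coeff (-((maxVal z).unbotD 0)))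

/-- The phase tropicalization `In_ν(X) ⊆ ℝ × ℂ⁴`. -/
def phaseTrop (X : Set (Fin 4 → HahnK)) : Set (ℝ × (Fin 4 → ℂ)) :=
  phase '' {z | z ∈ X ∧ z ≠ 0}

/-- The part `In_ν(X)_α` of level `α`, as a set of phases. -/
def phaseTropLevel (X : Set (Fin 4 → HahnK)) (α : ℝ) : Set (Fin 4 → ℂ) :=
  {θ | (α, θ) ∈ phaseTrop X}

/-- `𝕍_α(S)`: the common zeros in `g_α⁴` of polynomials over `gr_ν(𝕂)`, where `g_α = ℂ · [α]` is
identified with `ℂ`. -/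
def zerosAt (α : ℝ) (S : Set (MvPolynomial (Fin 4) GrK)) : Set (Fin 4 → ℂ) :=
  {θ | ∀ F ∈ S, MvPolynomial.eval (fun i => AddMonoidAlgebra.single α (θ i)) F = 0}

end PhaseTrop

end

/-! Put `x = t^α w` with `α > 0`. Dividing `det - 1` and `f` by their top powers of `t` gives
equations over the valuation ring: `det(w) = e` with `e = t^(-2α)` in the maximal ideal, and `F(w) =
0`. Modulo the maximal ideal they become `det = 0` and, up to a unit and the twist `X_i ↦ [-α] X_i`,
`IN_α(f) = 0`. Both claims say that this reduction loses nothing. Genericity means that no nonempty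
subsum of the leading coefficients vanishes. Hence the reduction of `F` is nonzero at the all-ones
matrix, which has rank one, so it is a nonzerodivisor modulo `det`. Initial ideal: a relation `H = A
(det - e) + B F` over `𝕂` can be made integral, since a denominator would reduce to a syzygy that
cannot exist (`res_mem_span`). So `IN_α(I)` is generated by `det` and `IN_α(f)`
(`initIdeal_surfaceIdeal`). Away from tropical roots this ideal is locally constant and homogeneous.
At a root, restriction to the line of scalar multiples of the all-ones matrix kills `det` and shows
that homogeneity fails (`isCriticalLevel_iff`). Level sets: reduction gives one inclusion. For the
other, a rank-one zero `θ` is moved along a curve inside `det = e`, and `F` acquires a root on the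
curve infinitesimally close to its start (`exists_lift_point`). That root, and the Nullstellensatz
identifying the vanishing ideal of `X`, rest on the algebraic closedness of `𝕂`, proved here by
spherical completeness. -/

noncomputable section

namespace PhaseTrop

/-! ### The valuation ring, its residue map, and rescaling by powers of `t`. -/

/-- The valuation ring of `𝕂`. -/
def HahnO : Subring HahnK where
  carrier := {c | ∀ y < 0, c.coeff y = 0}
  zero_mem' := by simp
  one_mem' := fun y hy => by rw [HahnSeries.coeff_one, if_neg hy.ne]
  add_mem' := fun {a b} ha hb y hy => by simp [ha y hy, hb y hy]
  neg_mem' := fun {a} ha y hy => by simp [ha y hy]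
  mul_mem' := fun {a b} ha hb y hy => by
    rw [HahnSeries.coeff_mul]
    refine Finset.sum_eq_zero fun ij hij => ?_
    rw [Finset.mem_antidiagonal] at hij
    rcases lt_or_ge ij.1 0 with h | h
    · rw [ha _ h, zero_mul]
    · rw [hb _ (by linarith [hij.2.2]), mul_zero]

lemma mem_HahnO {c : HahnK} : c ∈ HahnO ↔ ∀ y < 0, c.coeff y = 0 := Iff.rfl

/-- The residue map of the valuation ring. -/
def res : HahnO →+* ℂ where
  toFun c := c.1.coeff 0
  map_zero' := by simp
  map_one' := by simp [HahnSeries.coeff_one]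
  map_add' := by simp
  map_mul' := fun a b => by
    rw [Subring.coe_mul, HahnSeries.coeff_mul]
    rw [Finset.sum_eq_single (0, 0)]
    · rintro ⟨i, j⟩ hij hne
      rw [Finset.mem_antidiagonal] at hij
      dsimp only at hij ⊢
      rcases lt_trichotomy i 0 with h | h | h
      · rw [a.2 _ h, zero_mul]
      · exact absurd (by rw [Prod.mk.injEq]; exact ⟨h, by linarith [hij.2.2]⟩) hne
      · rw [b.2 _ (by linarith [hij.2.2] : j < 0), mul_zero]
    · intro h
      rw [Finset.mem_antidiagonal] at h
      simp only [HahnSeries.mem_support, add_zero, and_true, not_and_or, not_not] at h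
      rcases h with h | h <;> simp [h]

lemma res_apply (c : HahnO) : res c = c.1.coeff 0 := rfl

/-- The monomial `t ^ (-γ)`. -/
def tpow (γ : ℝ) : HahnK := HahnSeries.single γ 1

lemma coeff_tpow_mul (γ x : ℝ) (c : HahnK) : (tpow γ * c).coeff x = c.coeff (x - γ) := by
  simp [tpow, HahnSeries.coeff_single_mul]

lemma tpow_ne_zero (γ : ℝ) : tpow γ ≠ 0 := HahnSeries.single_ne_zero one_ne_zero

lemma tpow_add (γ δ : ℝ) : tpow (γ + δ) = tpow γ * tpow δ := by
  simp [tpow, HahnSeries.single_mul_single]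

@[simp] lemma tpow_zero : tpow 0 = 1 := rfl

lemma tpow_mul_neg (γ : ℝ) : tpow γ * tpow (-γ) = 1 := by rw [← tpow_add]; simp

lemma tpow_pow (γ : ℝ) (n : ℕ) : tpow γ ^ n = tpow (n * γ) := by
  simp [tpow, HahnSeries.single_pow]

lemma tpow_mem {γ : ℝ} (h : 0 ≤ γ) : tpow γ ∈ HahnO := fun y hy => by
  rw [tpow, HahnSeries.coeff_single_of_ne (by linarith)]

lemma tpow_mul_mem_iff {γ : ℝ} {c : HahnK} :
    tpow γ * c ∈ HahnO ↔ ∀ y < -γ, c.coeff y = 0 := by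
  simp only [mem_HahnO, coeff_tpow_mul]
  exact ⟨fun h y hy => by simpa using h (y + γ) (by linarith), fun h y hy => h _ (by linarith)⟩

lemma tpow_mul_mem {γ : ℝ} {c : HahnK} (h : c = 0 ∨ 0 ≤ γ + c.order) : tpow γ * c ∈ HahnO := by
  rcases h with rfl | h
  · simp [HahnO.zero_mem]
  · exact tpow_mul_mem_iff.2 fun y hy => HahnSeries.coeff_eq_zero_of_lt_order (by linarith)

lemma coeff_tpow_order {c : HahnK} (hc : c ≠ 0) : (tpow (-c.order) * c).coeff 0 ≠ 0 := by
  rw [coeff_tpow_mul, zero_sub, neg_neg]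
  exact mt HahnSeries.coeff_order_eq_zero.1 hc

lemma exists_scaling (S : Finset HahnK) (h : ∃ x ∈ S, x ≠ 0) :
    ∃ ρ : ℝ, (∀ x ∈ S, tpow ρ * x ∈ HahnO) ∧ ∃ x ∈ S, (tpow ρ * x).coeff 0 ≠ 0 := by
  classical
  obtain ⟨x₀, hx₀, h₀⟩ := h
  obtain ⟨m, hm, hmin⟩ := (S.filter (· ≠ 0)).exists_min_image (fun x => x.order)
    ⟨x₀, by simp [hx₀, h₀]⟩
  rw [Finset.mem_filter] at hm
  refine ⟨-m.order, fun x hx => tpow_mul_mem ?_, m, hm.1, coeff_tpow_order hm.2⟩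
  by_cases hx0 : x = 0
  · exact Or.inl hx0
  · exact Or.inr (by linarith [hmin x (by simp [hx, hx0])])

/-! ### `𝕂` is algebraically closed -/

section AlgClosed

open Polynomial

lemma exists_lift {q : HahnK[X]} (h : ∀ n, q.coeff n ∈ HahnO) :
    ∃ r : HahnO[X], r.map HahnO.subtype = q :=
  (mem_map_range HahnO.subtype).2 fun n => ⟨⟨_, h n⟩, rfl⟩

lemma map_subtype_injective : Function.Injective (Polynomial.map HahnO.subtype) :=
  Polynomial.map_injective _ Subtype.val_injective

/-- This is an extreme slope of the Newton polygon: `γ` is the largest of the numbers `-ord(q_i) /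
i` with `i ≥ 1`. Every rescaled coefficient is then integral, and one attaining the maximum is a
unit. -/
lemma exists_slope {q : HahnK[X]} (h0 : q.coeff 0 = 1) (hd : ∃ i, 1 ≤ i ∧ q.coeff i ≠ 0) :
    ∃ (γ : ℝ) (r : HahnO[X]), r.map HahnO.subtype = q.comp (C (tpow γ) * X) ∧
      ∃ i, 1 ≤ i ∧ (r.map res).coeff i ≠ 0 := by
  obtain ⟨i₀, hi₀, h₀⟩ := hd
  obtain ⟨m, hm, hmax⟩ := (q.support.erase 0).exists_max_image
    (fun i => -(q.coeff i).order / (i : ℝ)) ⟨i₀, by simp [h₀]; omega⟩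
  set γ : ℝ := -(q.coeff m).order / (m : ℝ) with hγ
  simp only [Finset.mem_erase, mem_support_iff] at hm hmax
  have hm0 : (m : ℝ) ≠ 0 := by exact_mod_cast hm.1
  have hco : ∀ i, (q.comp (C (tpow γ) * X)).coeff i = tpow (i * γ) * q.coeff i := fun i => by
    rw [comp_C_mul_X_coeff, tpow_pow, mul_comm]
  obtain ⟨r, hr⟩ := exists_lift (q := q.comp (C (tpow γ) * X)) fun i => by
    rw [hco]
    refine tpow_mul_mem ?_
    by_cases hi : i = 0
    · subst hi; simp [h0]
    by_cases hq : q.coeff i = 0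
    · exact Or.inl hq
    have hi' : (0 : ℝ) < i := by exact_mod_cast Nat.pos_of_ne_zero hi
    have := (div_le_iff₀ hi').1 (hmax i ⟨hi, hq⟩)
    exact Or.inr (by rw [mul_comm]; linarith)
  refine ⟨γ, r, hr, m, Nat.one_le_iff_ne_zero.2 hm.1, ?_⟩
  have h1 : ((r.coeff m : HahnO) : HahnK) = tpow (-(q.coeff m).order) * q.coeff m := by
    have h2 := congrArg (fun f => f.coeff m) hr
    simp only [coeff_map, hco] at h2
    rw [show (m : ℝ) * γ = -(q.coeff m).order by rw [hγ]; field_simp] at h2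
    exact h2
  rw [coeff_map, res_apply, h1]
  exact coeff_tpow_order hm.2

/-- The Taylor expansion of `p` at `a`, rescaled to the distance `γ` from `a` to the nearest
root and normalized to have constant term `1`. -/
structure IsExpansion (p : HahnK[X]) (a : HahnK) (γ : ℝ) (r : HahnO[X]) : Prop where
  comp_eq : p.comp (C a + C (tpow γ) * X) = C (p.eval a) * r.map HahnO.subtype
  nonconst : ∃ i, 1 ≤ i ∧ (r.map res).coeff i ≠ 0

lemma exists_expansion {p : HahnK[X]} (hp : 0 < p.natDegree) {a : HahnK} (ha : p.eval a ≠ 0) :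
    ∃ γ r, IsExpansion p a γ r := by
  obtain ⟨γ, r, hr, hi⟩ := exists_slope (q := C (p.eval a)⁻¹ * taylor a p)
    (by rw [coeff_C_mul, taylor_coeff_zero, inv_mul_cancel₀ ha])
    ⟨p.natDegree, hp, by
      rw [coeff_C_mul, ← natDegree_taylor p a, coeff_natDegree]
      refine mul_ne_zero (inv_ne_zero ha) ?_
      rw [leadingCoeff_ne_zero]
      intro h
      rw [← natDegree_taylor p a, h, natDegree_zero] at hp
      exact hp.false⟩
  refine ⟨γ, r, ?_, hi⟩
  rw [hr, mul_comp, C_comp, ← mul_assoc, ← C_mul, mul_inv_cancel₀ ha, C_1, one_mul, taylor_apply,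
    comp_assoc]
  congr 1
  simp [add_comm]

/-- Both sides come from expanding `p` at the same point, since `a + tpow γ (X + y) = b + tpow γ' (d
X)`; the factor `p(a)` is then cancelled. -/
lemma IsExpansion.compare {p : HahnK[X]} {a b : HahnK} {γ γ' : ℝ} {r r' : HahnO[X]}
    (h : IsExpansion p a γ r) (h' : IsExpansion p b γ' r') (ha : p.eval a ≠ 0) {y : HahnO}
    (hb : b = a + tpow γ * y) {d : HahnO} (hd : tpow γ = tpow γ' * d) :
    r.comp (X + C y) = C (r.eval y) * r'.comp (C d * X) := by
  have e1 := congrArg (fun f => f.comp (X + C (y : HahnK))) h.comp_eq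
  have e2 := congrArg (fun f => f.comp (C (d : HahnK) * X)) h'.comp_eq
  simp only [comp_assoc, mul_comp, C_comp, add_comp, X_comp] at e1 e2
  have e3 : C a + C (tpow γ) * (X + C (y : HahnK)) = C b + C (tpow γ') * (C (d : HahnK) * X) := by
    rw [hb, ← mul_assoc, ← C_mul, ← hd]
    simp only [map_add, map_mul]; ring
  rw [e3, e2] at e1
  have e4 : p.eval b = p.eval a * (r.eval y : HahnO) := by
    have := congrArg (fun f => f.eval (y : HahnK)) h.comp_eq
    simp only [eval_comp, eval_add, eval_C, eval_mul, eval_X] at this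
    rw [hb, this]
    congr 1
    exact (eval_map_apply HahnO.subtype y)
  apply map_subtype_injective
  rw [e4, C_mul, mul_assoc] at e1
  have e5 := mul_left_cancel₀ (C_ne_zero.2 ha) e1
  rw [Polynomial.map_comp, Polynomial.map_mul, Polynomial.map_comp]
  simpa using e5.symm

lemma comp_X_add_C_nonconst {q : ℂ[X]} (h : ∃ i, 1 ≤ i ∧ q.coeff i ≠ 0) (y k : ℂ) :
    q.comp (X + C y) ≠ C k := by
  intro e
  obtain ⟨i, hi, hq⟩ := h
  have := congrArg (fun f => f.comp (X - C y)) e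
  simp only [comp_assoc, add_comp, X_comp, C_comp, sub_add_cancel, comp_X] at this
  rw [this, coeff_C, if_neg (by omega)] at hq
  exact hq rfl

/-- If `γ > γ'`, the factor `d = tpow (γ - γ')` reduces to `0`, so `compare` would make a translate
of the nonconstant reduction of `r` constant. -/
lemma IsExpansion.le {p : HahnK[X]} {a b : HahnK} {γ γ' : ℝ} {r r' : HahnO[X]}
    (h : IsExpansion p a γ r) (h' : IsExpansion p b γ' r') (ha : p.eval a ≠ 0)
    {y : HahnO} (hb : b = a + tpow γ * y) : γ ≤ γ' := by
  by_contra! hlt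
  have hd : (0 : ℝ) < γ - γ' := by linarith
  have e := h.compare h' ha hb (d := ⟨tpow (γ - γ'), tpow_mem hd.le⟩)
    (by rw [← tpow_add]; congr 1; ring)
  have e1 := congrArg (Polynomial.map res) e
  have e2 : res ⟨tpow (γ - γ'), tpow_mem hd.le⟩ = 0 := by
    exact HahnSeries.coeff_single_of_ne hd.ne
  simp only [Polynomial.map_comp, Polynomial.map_mul, Polynomial.map_add, map_C, map_X, e2, C_0,
    zero_mul, comp_zero, ← C_mul] at e1
  exact comp_X_add_C_nonconst h.nonconst _ _ e1

/-- When `r(y)` reduces to `0`, the right side of `compare` reduces to `0` even if `γ = γ'`, which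
also excludes equality. -/
lemma IsExpansion.lt {p : HahnK[X]} {a b : HahnK} {γ γ' : ℝ} {r r' : HahnO[X]}
    (h : IsExpansion p a γ r) (h' : IsExpansion p b γ' r') (ha : p.eval a ≠ 0)
    {y : HahnO} (hb : b = a + tpow γ * y) (hy : res (r.eval y) = 0) : γ < γ' := by
  by_contra! hle
  have hd : (0 : ℝ) ≤ γ - γ' := by linarith
  have e := h.compare h' ha hb (d := ⟨tpow (γ - γ'), tpow_mem hd⟩)
    (by rw [← tpow_add]; congr 1; ring)
  have e1 := congrArg (Polynomial.map res) e
  simp only [Polynomial.map_comp, Polynomial.map_mul, Polynomial.map_add, map_C, map_X, hy, C_0,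
    zero_mul] at e1
  exact comp_X_add_C_nonconst h.nonconst _ 0 (by rw [e1, C_0])

/-- Spherical completeness: a nested family of balls has a common point, obtained by gluing the
coefficients known on each ball. -/
lemma exists_pseudolimit (S : Set HahnK) (g : HahnK → ℝ)
    (h : ∀ a ∈ S, ∀ b ∈ S, g a ≤ g b → ∀ x < g a, a.coeff x = b.coeff x) :
    ∃ l : HahnK, ∀ a ∈ S, ∀ x < g a, l.coeff x = a.coeff x := by
  classical
  let F : ℝ → ℂ := fun x => if hx : ∃ a ∈ S, x < g a then (Classical.choose hx).coeff x else 0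
  have hF : ∀ a ∈ S, ∀ x < g a, F x = a.coeff x := by
    intro a ha x hx
    have hex : ∃ a ∈ S, x < g a := ⟨a, ha, hx⟩
    simp only [F, dif_pos hex]
    obtain ⟨h1, h2⟩ := Classical.choose_spec hex
    rcases le_total (g a) (g (Classical.choose hex)) with hle | hle
    · exact (h a ha _ h1 hle x hx).symm
    · exact h _ h1 a ha hle x h2
  -- A descending sequence in the support stays below the radius `g a` that covers its first term,
  -- so it lies in the well-ordered support of `a`.
  have hwf : (Function.support F).IsPWO := by
    rw [Set.isPWO_iff_isWF, Set.isWF_iff_no_descending_seq]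
    intro f hf hmem
    have h0 : ∃ a ∈ S, f 0 < g a := by
      by_contra hne
      exact hmem 0 (by simp only [F, dif_neg hne])
    obtain ⟨a, ha, hlt⟩ := h0
    refine (Set.isWF_iff_no_descending_seq.1 a.isWF_support) f hf fun n => ?_
    have hn : f n < g a := lt_of_le_of_lt (hf.antitone (Nat.zero_le n)) hlt
    rw [HahnSeries.mem_support, ← hF a ha _ hn]
    exact hmem n
  exact ⟨⟨F, hwf⟩, hF⟩

lemma exists_add_tpow_mul {a b : HahnK} {γ : ℝ} (h : ∀ x < γ, a.coeff x = b.coeff x) :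
    ∃ y : HahnO, b = a + tpow γ * y := by
  refine ⟨⟨tpow (-γ) * (b - a), tpow_mul_mem_iff.2 fun y hy => ?_⟩, ?_⟩
  · rw [neg_neg] at hy
    simp [h y hy]
  · rw [← mul_assoc, tpow_mul_neg, one_mul, add_sub_cancel]

/-- For a rootless irreducible `p`, Zorn's lemma with pseudolimits gives a centre `m` whose ball
cannot be improved. The reduced expansion at `m` is nonconstant, so it has a root `c` in `ℂ`, and `m
+ tpow (g m) c` is a strictly better centre. -/
instance : IsAlgClosed HahnK := by
  refine IsAlgClosed.of_exists_root _ fun p _ hirr => ?_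
  by_contra! hroot
  choose g r hg using fun a => exists_expansion hirr.natDegree_pos (hroot a)
  obtain ⟨m, hm⟩ := exists_maximal_of_chains_bounded
    (r := fun a b : HahnK => (∀ x < g a, a.coeff x = b.coeff x) ∧ g a ≤ g b)
    (fun c hc => by
      obtain ⟨l, hl⟩ := exists_pseudolimit c g fun a ha b hb hab x hx => by
        rcases eq_or_ne a b with rfl | hne
        · rfl
        rcases hc ha hb hne with h | h
        · exact h.1 x hx
        · exact (h.1 x (by linarith)).symm
      refine ⟨l, fun a ha => ⟨fun x hx => (hl a ha x hx).symm, ?_⟩⟩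
      obtain ⟨y, hy⟩ := exists_add_tpow_mul fun x hx => (hl a ha x hx).symm
      exact (hg a).le (hg l) (hroot a) hy)
    (fun {a b c} hab hbc => ⟨fun x hx => (hab.1 x hx).trans (hbc.1 x (by linarith [hab.2])),
      hab.2.trans hbc.2⟩)
  obtain ⟨c, hc⟩ := IsAlgClosed.exists_root ((r m).map res) (by
    intro h0
    obtain ⟨i, hi, hne⟩ := (hg m).nonconst
    exact hne (coeff_eq_zero_of_degree_lt (by rw [h0]; exact_mod_cast hi)))
  let y : HahnO := ⟨HahnSeries.C c, fun x hx => by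
    rw [HahnSeries.C_apply, HahnSeries.coeff_single_of_ne hx.ne]⟩
  have hy : res y = c := by
    exact HahnSeries.coeff_single_same 0 c
  have hlt := (hg m).lt (hg (m + tpow (g m) * y)) (hroot m) rfl (by
    rw [← eval_map_apply, hy]; exact hc)
  refine absurd (hm (m + tpow (g m) * y) ⟨fun x hx => ?_, hlt.le⟩).2 (not_le.2 hlt)
  rw [HahnSeries.coeff_add, coeff_tpow_mul, y.2 _ (by linarith), add_zero]

lemma X_sub_C_eq_C_mul {F : Type*} [Field F] {a : F} (ha : a ≠ 0) :
    X - C a = C (-a) * (1 - C a⁻¹ * X) := by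
  have h1 : C a * C a⁻¹ = (1 : F[X]) := by rw [← C_mul, mul_inv_cancel₀ ha, C_1]
  rw [C_neg]
  linear_combination (-X) * h1

/-- A polynomial over the valuation ring whose reduction is nonzero and vanishes at `0` has a root
in the maximal ideal. -/
lemma exists_root_residue_zero {q : HahnO[X]} (hq : q.map res ≠ 0)
    (h0 : (q.map res).eval 0 = 0) : ∃ s : HahnO, res s = 0 ∧ q.eval s = 0 := by
  by_contra! hno
  have hq0 : q ≠ 0 := by rintro rfl; simp at hq
  set Q := q.map HahnO.subtype with hQ
  have hQ0 : Q ≠ 0 := fun h => hq0 (map_subtype_injective (by rw [← hQ, h, Polynomial.map_zero]))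
  have hev : ∀ s : HahnO, Q.eval (s : HahnK) = (q.eval s : HahnO) := fun s =>
    eval_map_apply HahnO.subtype s
  -- With no root in the maximal ideal, every factor `X - a` equals `-a (1 - a⁻¹ X)` with `a⁻¹`
  -- integral. Hence `q = q(0) r` with `r` integral, and `q(0)` reduces to `0`, so `q` would too.
  have hroots : ∀ a ∈ Q.roots, a ≠ 0 ∧ a⁻¹ ∈ HahnO := by
    intro a ha
    have ha' : Q.eval a = 0 := ((mem_roots hQ0).1 ha)
    have key : ¬ (0 < a.orderTop) := by
      intro hpos
      have hm : a ∈ HahnO := fun y hy => HahnSeries.coeff_eq_zero_of_lt_orderTop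
        (lt_trans (by exact_mod_cast hy) hpos)
      refine hno ⟨a, hm⟩ (HahnSeries.coeff_eq_zero_of_lt_orderTop hpos) ?_
      exact Subtype.val_injective (by rw [← hev]; exact ha')
    have hne : a ≠ 0 := by rintro rfl; simp at key
    refine ⟨hne, ?_⟩
    rw [HahnSeries.zero_lt_orderTop_iff hne, not_lt] at key
    have h1 : (a * a⁻¹).order = a.order + a⁻¹.order := HahnSeries.order_mul hne (inv_ne_zero hne)
    rw [mul_inv_cancel₀ hne, HahnSeries.order_one] at h1
    exact fun y hy => HahnSeries.coeff_eq_zero_of_lt_order (by linarith)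
  have hprod : ∀ s : Multiset HahnK, (∀ a ∈ s, a ≠ 0 ∧ a⁻¹ ∈ HahnO) →
      ∃ (k : HahnK) (r : HahnO[X]), r.eval 0 = 1 ∧
        (s.map fun a => X - C a).prod = C k * r.map HahnO.subtype := by
    intro s
    induction s using Multiset.induction with
    | empty => exact fun _ => ⟨1, 1, by simp⟩
    | cons a s ih =>
      intro hs
      obtain ⟨k, r, hr, e⟩ := ih fun b hb => hs b (Multiset.mem_cons_of_mem hb)
      obtain ⟨hne, hm⟩ := hs a (Multiset.mem_cons_self a s)
      refine ⟨-a * k, (1 - C ⟨a⁻¹, hm⟩ * X) * r, by simp [hr], ?_⟩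
      rw [Multiset.map_cons, Multiset.prod_cons, e]
      have := X_sub_C_eq_C_mul hne
      simp only [this, Polynomial.map_mul, Polynomial.map_sub, Polynomial.map_one, map_C, map_X,
        Subring.subtype_apply, C_mul]
      ring
  obtain ⟨k, r, hr, e⟩ := hprod Q.roots hroots
  have hfac : Q = C (Q.leadingCoeff * k) * r.map HahnO.subtype := by
    rw [C_mul, mul_assoc, ← e]
    exact (IsAlgClosed.splits Q).eq_prod_roots
  have h1 := congrArg (fun f => f.eval ((0 : HahnO) : HahnK)) hfac
  simp only [eval_mul, eval_C, hev] at h1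
  have h2 : (r.map HahnO.subtype).eval ((0 : HahnO) : HahnK) = 1 := by
    rw [show ((0 : HahnO) : HahnK) = HahnO.subtype 0 from rfl, eval_map_apply, hr, map_one]
  rw [h2, mul_one] at h1
  have h3 : q = C (q.eval 0) * r := by
    apply map_subtype_injective
    rw [← hQ, hfac, ← h1, Polynomial.map_mul, map_C]
    rfl
  have h4 : res (q.eval 0) = 0 := by
    rw [← eval_map_apply, map_zero]; exact h0
  apply hq
  rw [h3, Polynomial.map_mul, map_C, h4, C_0, zero_mul]

end AlgClosed

/-! ### Initial forms as reductions modulo the maximal ideal -/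

section Models

open MvPolynomial

lemma coeff_rescale {R : Type*} [CommRing R] (a : R) (h : MvPolynomial (Fin 4) R)
    (u : Fin 4 →₀ ℕ) :
    (aeval (fun i => C a * X i : Fin 4 → MvPolynomial (Fin 4) R) h).coeff u =
      h.coeff u * a ^ u.degree := by
  induction h using MvPolynomial.induction_on' with
  | monomial v c =>
    have : aeval (fun i => C a * X i : Fin 4 → MvPolynomial (Fin 4) R) (monomial v c) =
        monomial v (c * a ^ v.degree) := by
      rw [aeval_monomial, Finsupp.prod_fintype _ _ (by simp), monomial_eq,
        Finsupp.prod_fintype _ _ (by simp)]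
      simp only [mul_pow, Finset.prod_mul_distrib, Finset.prod_pow_eq_pow_sum, algebraMap_eq,
        Finsupp.degree_eq_sum, C_mul, C_pow]
      ring
    rw [this, coeff_monomial, coeff_monomial]
    split_ifs with h
    · rw [h]
    · rw [zero_mul]
  | add p q hp hq => rw [map_add, coeff_add, hp, hq, coeff_add, add_mul]

/-- The substitution `x_i ↦ t ^ α x_i`. -/
def scaleVars (α : ℝ) : MvPolynomial (Fin 4) HahnK →ₐ[HahnK] MvPolynomial (Fin 4) HahnK :=
  aeval fun i => C (tpow (-α)) * X i

lemma coeff_scaleVars (α : ℝ) (h : MvPolynomial (Fin 4) HahnK) (u : Fin 4 →₀ ℕ) :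
    (scaleVars α h).coeff u = tpow (-(α * u.degree)) * h.coeff u := by
  rw [scaleVars, coeff_rescale, tpow_pow, mul_comm]
  congr 2
  ring

/-- `h'` is the polynomial `t ^ (-τ) h(t ^ α x)`, which has coefficients in the valuation ring. -/
def IsModel (α τ : ℝ) (h : MvPolynomial (Fin 4) HahnK) (h' : MvPolynomial (Fin 4) HahnO) : Prop :=
  map HahnO.subtype h' = C (tpow τ) * scaleVars α h

lemma IsModel.coeff {α τ : ℝ} {h : MvPolynomial (Fin 4) HahnK} {h' : MvPolynomial (Fin 4) HahnO}
    (hm : IsModel α τ h h') (u : Fin 4 →₀ ℕ) :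
    ((h'.coeff u : HahnO) : HahnK) = tpow (τ - α * u.degree) * h.coeff u := by
  have := congrArg (fun f => f.coeff u) hm
  simp only [coeff_map, coeff_C_mul, coeff_scaleVars] at this
  rw [← mul_assoc, ← tpow_add] at this
  exact this

lemma exists_mvLift {h : MvPolynomial (Fin 4) HahnK} (hc : ∀ u, h.coeff u ∈ HahnO) :
    ∃ h' : MvPolynomial (Fin 4) HahnO, map HahnO.subtype h' = h := by
  have : h ∈ (map (σ := Fin 4) HahnO.subtype).range := by
    rw [RingHom.mem_range, ← Set.mem_range, MvPolynomial.mem_range_map_iff_coeffs_subset]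
    intro x hx
    rw [Finset.mem_coe, mem_coeffs_iff] at hx
    obtain ⟨u, _, rfl⟩ := hx
    exact ⟨⟨_, hc u⟩, rfl⟩
  exact this

lemma mvMap_subtype_injective : Function.Injective (map (σ := Fin 4) HahnO.subtype) :=
  map_injective _ Subtype.val_injective

lemma termVal_eq {f : MvPolynomial (Fin 4) HahnK} {u : Fin 4 →₀ ℕ} (hu : u ∈ f.support) (α : ℝ) :
    termVal f α u = ((-(f.coeff u).order + α * u.degree : ℝ) : WithBot ℝ) := by
  rw [termVal, nu, if_neg (mem_support_iff.1 hu)]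
  rfl

lemma trop_eq_iff {f : MvPolynomial (Fin 4) HahnK} (hf : f ≠ 0) {α τ : ℝ} :
    trop f α = (τ : WithBot ℝ) ↔
      (∀ u ∈ f.support, -(f.coeff u).order + α * u.degree ≤ τ) ∧
        ∃ u ∈ f.support, -(f.coeff u).order + α * u.degree = τ := by
  constructor
  · intro h
    refine ⟨fun u hu => ?_, ?_⟩
    · have := Finset.le_sup (f := termVal f α) hu
      change _ ≤ trop f α at this
      rw [h, termVal_eq hu] at this
      exact_mod_cast this
    · obtain ⟨u, hu, e⟩ := Finset.exists_mem_eq_sup f.support (support_nonempty.2 hf) (termVal f α)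
      change trop f α = _ at e
      rw [h, termVal_eq hu] at e
      exact ⟨u, hu, by exact_mod_cast e.symm⟩
  · rintro ⟨h1, u, hu, h2⟩
    refine le_antisymm (Finset.sup_le fun v hv => ?_) ?_
    · rw [termVal_eq hv]
      exact_mod_cast h1 v hv
    · rw [← h2, ← termVal_eq hu]
      exact Finset.le_sup (f := termVal f α) hu

lemma exists_trop_eq {f : MvPolynomial (Fin 4) HahnK} (hf : f ≠ 0) (α : ℝ) :
    ∃ τ : ℝ, trop f α = (τ : WithBot ℝ) := by
  obtain ⟨u, hu, e⟩ := Finset.exists_mem_eq_sup f.support (support_nonempty.2 hf) (termVal f α)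
  exact ⟨_, e.trans (termVal_eq hu α)⟩

lemma exists_model {f : MvPolynomial (Fin 4) HahnK} (hf : f ≠ 0) {α τ : ℝ}
    (hτ : trop f α = (τ : WithBot ℝ)) : ∃ f', IsModel α τ f f' := by
  refine exists_mvLift fun u => ?_
  rw [coeff_C_mul, coeff_scaleVars, ← mul_assoc, ← tpow_add]
  refine tpow_mul_mem ?_
  by_cases hu : f.coeff u = 0
  · exact Or.inl hu
  · exact Or.inr (by linarith [((trop_eq_iff hf).1 hτ).1 u (mem_support_iff.2 hu)])

/-- Integrality bounds every term by `τ`, and a coefficient surviving reduction attains the bound.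
-/
lemma IsModel.trop_eq {α τ : ℝ} {h : MvPolynomial (Fin 4) HahnK} {h' : MvPolynomial (Fin 4) HahnO}
    (hm : IsModel α τ h h') (hr : map res h' ≠ 0) : h ≠ 0 ∧ trop h α = (τ : WithBot ℝ) := by
  have hle : ∀ u, h.coeff u ≠ 0 → -(h.coeff u).order + α * u.degree ≤ τ := fun u hu => by
    have h1 := (h'.coeff u).2
    rw [hm.coeff, tpow_mul_mem_iff] at h1
    by_contra! hlt
    exact hu (HahnSeries.coeff_order_eq_zero.1 (h1 _ (by linarith)))
  obtain ⟨u, hu⟩ := ne_zero_iff.1 hr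
  rw [coeff_map, res_apply, hm.coeff, coeff_tpow_mul] at hu
  have hu0 : h.coeff u ≠ 0 := HahnSeries.ne_zero_of_coeff_ne_zero hu
  have h0 : h ≠ 0 := ne_zero_iff.2 ⟨u, hu0⟩
  refine ⟨h0, (trop_eq_iff h0).2 ⟨fun v hv => hle v (mem_support_iff.1 hv), u,
    mem_support_iff.2 hu0, le_antisymm (hle u hu0) ?_⟩⟩
  linarith [HahnSeries.order_le_of_coeff_ne_zero hu]

open Classical in
lemma IsModel.coeff_res {α τ : ℝ} {h : MvPolynomial (Fin 4) HahnK}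
    {h' : MvPolynomial (Fin 4) HahnO} (hm : IsModel α τ h h')
    (hτ : trop h α = (τ : WithBot ℝ)) (u : Fin 4 →₀ ℕ) :
    (map res h').coeff u =
      if u ∈ h.support ∧ termVal h α u = trop h α then (h.coeff u).leadingCoeff else 0 := by
  rw [coeff_map, res_apply, hm.coeff, coeff_tpow_mul]
  by_cases hu : u ∈ h.support
  · have hh : h ≠ 0 := by rintro rfl; simp at hu
    have hle := ((trop_eq_iff hh).1 hτ).1 u hu
    rw [hτ, termVal_eq hu]
    simp only [hu, true_and, WithBot.coe_inj]
    split_ifs with he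
    · rw [HahnSeries.leadingCoeff_eq]
      congr 1; linarith
    · exact HahnSeries.coeff_eq_zero_of_lt_order
        (by linarith [lt_of_le_of_ne hle he])
  · rw [if_neg (fun h => hu h.1), notMem_support_iff.1 hu, HahnSeries.coeff_zero]

/-- The embedding of `ℂ[X]` into `gr_ν(𝕂)[X]` with `X_i ↦ [-α] X_i`. -/
def twist (α : ℝ) : MvPolynomial (Fin 4) ℂ →+* MvPolynomial (Fin 4) GrK :=
  (aeval (fun i => C (AddMonoidAlgebra.single (-α) 1) * X i :
    Fin 4 → MvPolynomial (Fin 4) GrK)).toRingHom.comp (map (algebraMap ℂ GrK))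

lemma coeff_twist (α : ℝ) (p : MvPolynomial (Fin 4) ℂ) (u : Fin 4 →₀ ℕ) :
    (twist α p).coeff u = AddMonoidAlgebra.single (-(α * u.degree)) (p.coeff u) := by
  rw [twist, RingHom.comp_apply, AlgHom.toRingHom_eq_coe, RingHom.coe_coe, coeff_rescale,
    coeff_map, AddMonoidAlgebra.single_pow]
  simp [AddMonoidAlgebra.single_mul_single]
  ring_nf

open Classical in
lemma coeff_initPoly (α : ℝ) (f : MvPolynomial (Fin 4) HahnK) (u : Fin 4 →₀ ℕ) :
    (initPoly α f).coeff u =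
      if u ∈ f.support ∧ termVal f α u = trop f α then initForm (f.coeff u) else 0 := by
  rw [initPoly, coeff_sum]
  simp only [coeff_monomial, Finset.sum_ite_eq', Finset.mem_filter]

/-- The dictionary between graded and residual data: up to the unit `[τ]` and the substitution
`twist`, taking the initial form is reduction modulo the maximal ideal. -/
lemma IsModel.initPoly_eq {α τ : ℝ} {h : MvPolynomial (Fin 4) HahnK}
    {h' : MvPolynomial (Fin 4) HahnO} (hm : IsModel α τ h h')
    (hτ : trop h α = (τ : WithBot ℝ)) :
    initPoly α h = C (AddMonoidAlgebra.single τ 1) * twist α (map res h') := by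
  classical
  ext1 u
  rw [coeff_initPoly, coeff_C_mul, coeff_twist, hm.coeff_res hτ, AddMonoidAlgebra.single_mul_single]
  split_ifs with hu
  · have e := hu.2
    rw [hτ, termVal_eq hu.1, WithBot.coe_inj] at e
    rw [initForm, nu, if_neg (mem_support_iff.1 hu.1), one_mul, WithBot.unbotD_coe]
    congr 1
    linarith
  · simp

lemma IsModel.twist_eq {α τ : ℝ} {h : MvPolynomial (Fin 4) HahnK}
    {h' : MvPolynomial (Fin 4) HahnO} (hm : IsModel α τ h h')
    (hτ : trop h α = (τ : WithBot ℝ)) :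
    twist α (map res h') = C (AddMonoidAlgebra.single (-τ) 1) * initPoly α h := by
  rw [hm.initPoly_eq hτ, ← mul_assoc, ← C_mul, AddMonoidAlgebra.single_mul_single]
  simp [← AddMonoidAlgebra.one_def]

end Models

/-! ### The initial ideal of the surface -/

section InitialIdeal

open MvPolynomial

lemma detPoly_eq (R : Type) [CommRing R] : detPoly R = X 0 * X 3 - X 1 * X 2 :=
  Matrix.det_fin_two_of _ _ _ _

lemma map_detPoly {R S : Type} [CommRing R] [CommRing S] (φ : R →+* S) :
    map φ (detPoly R) = detPoly S := by
  simp [detPoly_eq]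

/-! ### Normal forms modulo `det - e` and the Segre parametrization. -/

/-- No monomial of the polynomial is divisible by `x₀ x₃`. -/
def IsNormal {R : Type} [CommRing R] (p : MvPolynomial (Fin 4) R) : Prop :=
  ∀ u, p.coeff u ≠ 0 → u 0 = 0 ∨ u 3 = 0

lemma IsNormal.add {R : Type} [CommRing R] {p q : MvPolynomial (Fin 4) R} (hp : IsNormal p)
    (hq : IsNormal q) : IsNormal (p + q) := fun u hu => by
  by_cases h : p.coeff u = 0
  · exact hq u fun h' => hu (by rw [coeff_add, h, h', add_zero])
  · exact hp u h

/-- Rewriting `x₀ x₃ = x₁ x₂ + e + (det - e)` lowers the exponent of `x₀` by one, which is the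
induction parameter `n`. -/
lemma exists_normal_monomial {R : Type} [CommRing R] (e : R) (n : ℕ) :
    ∀ (u : Fin 4 →₀ ℕ) (c : R), u 0 = n → ∃ N A : MvPolynomial (Fin 4) R,
      IsNormal N ∧ monomial u c = N + A * (detPoly R - C e) := by
  induction n with
  | zero =>
    intro u c hu
    refine ⟨monomial u c, 0, fun v hv => ?_, by simp⟩
    rw [coeff_monomial] at hv
    split_ifs at hv with h
    · exact Or.inl (h ▸ hu)
    · exact absurd rfl hv
  | succ n ih =>
    intro u c hu
    by_cases h3 : u 3 = 0
    · refine ⟨monomial u c, 0, fun v hv => ?_, by simp⟩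
      rw [coeff_monomial] at hv
      split_ifs at hv with h
      · exact Or.inr (h ▸ h3)
      · exact absurd rfl hv
    obtain ⟨w, hw⟩ : ∃ w : Fin 4 →₀ ℕ,
        u = w + (Finsupp.single 0 1 + Finsupp.single 3 1) := by
      refine ⟨u - (Finsupp.single 0 1 + Finsupp.single 3 1), (tsub_add_cancel_of_le ?_).symm⟩
      intro i
      fin_cases i <;> simp <;> omega
    have hw0 : w 0 = n := by
      have := congrArg (fun v => v 0) hw
      simp at this
      omega
    obtain ⟨N₁, A₁, hN₁, e₁⟩ :=
      ih (w + (Finsupp.single 1 1 + Finsupp.single 2 1)) c (by simpa [Finsupp.single_apply])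
    obtain ⟨N₂, A₂, hN₂, e₂⟩ := ih w (c * e) hw0
    have m1 : ∀ i j : Fin 4, monomial (w + (Finsupp.single i 1 + Finsupp.single j 1)) c =
        monomial w c * (X i * X j) := fun i j => by
      simp [X, monomial_mul]
    have m2 : monomial w (c * e) = monomial w c * C e := by
      rw [mul_comm (monomial w c), C_mul_monomial, mul_comm e]
    refine ⟨N₁ + N₂, monomial w c + A₁ + A₂, hN₁.add hN₂, ?_⟩
    rw [m1] at e₁
    rw [m2] at e₂
    rw [hw, m1, detPoly_eq] at *
    linear_combination e₁ + e₂

lemma exists_normal {R : Type} [CommRing R] (e : R) (B : MvPolynomial (Fin 4) R) :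
    ∃ N A : MvPolynomial (Fin 4) R, IsNormal N ∧ B = N + A * (detPoly R - C e) := by
  induction B using MvPolynomial.induction_on' with
  | monomial u c => exact exists_normal_monomial e _ u c rfl
  | add p q hp hq =>
    obtain ⟨N₁, A₁, hN₁, e₁⟩ := hp
    obtain ⟨N₂, A₂, hN₂, e₂⟩ := hq
    exact ⟨N₁ + N₂, A₁ + A₂, hN₁.add hN₂, by linear_combination e₁ + e₂⟩

/-- The parametrization of the matrices of rank at most one by pairs of vectors. -/
def segre : MvPolynomial (Fin 4) ℂ →ₐ[ℂ] MvPolynomial (Fin 4) ℂ :=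
  aeval ![X 0 * X 2, X 0 * X 3, X 1 * X 2, X 1 * X 3]

/-- The effect of `segre` on exponents. -/
def segreExp (u : Fin 4 →₀ ℕ) : Fin 4 →₀ ℕ :=
  Finsupp.equivFunOnFinite.symm ![u 0 + u 1, u 2 + u 3, u 0 + u 2, u 1 + u 3]

lemma segre_monomial (u : Fin 4 →₀ ℕ) (c : ℂ) :
    segre (monomial u c) = monomial (segreExp u) c := by
  rw [segre, aeval_monomial, monomial_eq, Finsupp.prod_fintype _ _ (by simp),
    Finsupp.prod_fintype _ _ (by simp)]
  simp only [Fin.prod_univ_four, segreExp, algebraMap_eq, Matrix.cons_val_zero, Matrix.cons_val_one,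
    Matrix.cons_val, Finsupp.equivFunOnFinite_symm_apply_apply]
  ring

/-- `segreExp` records the row and column sums of a `2 × 2` exponent matrix. These fix it up to
multiples of `(1, -1; -1, 1)`, and a zero on the diagonal of both matrices removes that freedom. -/
lemma segreExp_inj {u v : Fin 4 →₀ ℕ} (hu : u 0 = 0 ∨ u 3 = 0) (hv : v 0 = 0 ∨ v 3 = 0)
    (h : segreExp u = segreExp v) : u = v := by
  have h' : ∀ i, segreExp u i = segreExp v i := fun i => by rw [h]
  have h0 := h' 0
  have h1 := h' 1
  have h2 := h' 2
  have h3 := h' 3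
  simp [segreExp] at h0 h1 h2 h3
  ext i
  fin_cases i <;> simp <;> omega

lemma eq_zero_of_segre_eq_zero {N : MvPolynomial (Fin 4) ℂ} (hN : IsNormal N)
    (h : segre N = 0) : N = 0 := by
  classical
  ext1 u
  by_contra hu
  rw [coeff_zero] at hu
  have e : segre N = ∑ v ∈ N.support, monomial (segreExp v) (N.coeff v) := by
    conv_lhs => rw [N.as_sum, map_sum]
    simp only [segre_monomial]
  have h1 := congrArg (fun p => p.coeff (segreExp u)) e
  simp only [h, coeff_zero, coeff_sum, coeff_monomial] at h1
  rw [Finset.sum_eq_single u] at h1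
  · rw [if_pos rfl] at h1
    exact hu h1.symm
  · intro v hv hne
    rw [if_neg fun h2 => hne (segreExp_inj (hN v (mem_support_iff.1 hv)) (hN u hu) h2)]
  · intro hu'
    exact absurd (mem_support_iff.2 hu) hu'

lemma segre_detPoly : segre (detPoly ℂ) = 0 := by
  simp [detPoly_eq, segre]
  ring

lemma eval_segre (p : MvPolynomial (Fin 4) ℂ) (z : Fin 4 → ℂ) :
    eval z (segre p) = eval ![z 0 * z 2, z 0 * z 3, z 1 * z 2, z 1 * z 3] p := by
  have : (eval z).comp segre.toRingHom =
      eval ![z 0 * z 2, z 0 * z 3, z 1 * z 2, z 1 * z 3] := by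
    apply MvPolynomial.ringHom_ext
    · intro r; simp [segre]
    · intro i; fin_cases i <;> simp [segre]
  exact congrArg (fun φ => φ p) this

lemma segre_ne_zero {g : MvPolynomial (Fin 4) ℂ} (hg : eval 1 g ≠ 0) : segre g ≠ 0 := by
  intro h
  apply hg
  have := eval_segre g 1
  rw [h, map_zero] at this
  rw [this]
  congr 2
  ext i; fin_cases i <;> simp

lemma detPoly_ne_zero : detPoly ℂ ≠ 0 := by
  intro h
  have := congrArg (eval ![1, 0, 0, 1]) h
  simp [detPoly_eq] at this

/-- Under `segre` the relation becomes `segre B * segre g = 0` in a domain, and `segre` is injective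
on normal polynomials. -/
lemma normal_syzygy {A B g : MvPolynomial (Fin 4) ℂ} (hg : eval 1 g ≠ 0) (hB : IsNormal B)
    (h : A * detPoly ℂ + B * g = 0) : A = 0 ∧ B = 0 := by
  have h1 := congrArg segre h
  rw [map_add, map_mul, map_mul, segre_detPoly, mul_zero, zero_add, map_zero] at h1
  have hB0 := eq_zero_of_segre_eq_zero hB ((mul_eq_zero.1 h1).resolve_right (segre_ne_zero hg))
  rw [hB0, zero_mul, add_zero] at h
  exact ⟨(mul_eq_zero.1 h).resolve_right detPoly_ne_zero, hB0⟩

lemma IsNormal.map {R S : Type} [CommRing R] [CommRing S] (φ : R →+* S)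
    {p : MvPolynomial (Fin 4) R} (hp : IsNormal p) : IsNormal (map φ p) := fun u hu =>
  hp u fun h => hu (by rw [coeff_map, h, map_zero])

/-- This is flatness of the degeneration `det = e` to `det = 0`. Once `B` is in normal form, the
representation cannot involve denominators, because clearing them would leave a nontrivial normal
syzygy between `det` and the reduction of `F`. -/
lemma res_mem_span {F H : MvPolynomial (Fin 4) HahnO} (hF : eval 1 (map res F) ≠ 0) {e : HahnO}
    (he : res e = 0) {A B : MvPolynomial (Fin 4) HahnK}
    (h : map HahnO.subtype H = A * (detPoly HahnK - C (e : HahnK)) + B * map HahnO.subtype F) :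
    map res H ∈ Ideal.span {detPoly ℂ, map res F} := by
  classical
  obtain ⟨N, A', hN, hB⟩ := exists_normal (e : HahnK) B
  set A₁ := A + A' * map HahnO.subtype F with hA₁
  have h' : map HahnO.subtype H =
      A₁ * (detPoly HahnK - C (e : HahnK)) + N * map HahnO.subtype F := by
    rw [h, hB, hA₁]; ring
  by_cases h0 : A₁ = 0 ∧ N = 0
  · have : H = 0 := mvMap_subtype_injective (by rw [h', h0.1, h0.2]; simp)
    rw [this, map_zero]
    exact Ideal.zero_mem _
  -- The element `0` is added so that `hρ` also covers vanishing coefficients.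
  obtain ⟨ρ, hρ, x, hx, hx0⟩ := exists_scaling (insert 0 (A₁.coeffs ∪ N.coeffs)) (by
    by_contra! hall
    refine h0 ⟨?_, ?_⟩ <;> ext1 u <;> by_contra hu <;> refine hu (hall _ ?_) <;>
      simp [coeff_mem_coeffs _ hu])
  have hlift : ∀ Q : MvPolynomial (Fin 4) HahnK, Q.coeffs ⊆ insert 0 (A₁.coeffs ∪ N.coeffs) →
      ∃ Q' : MvPolynomial (Fin 4) HahnO, map HahnO.subtype Q' = C (tpow ρ) * Q := fun Q hQ =>
    exists_mvLift fun u => by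
      rw [coeff_C_mul]
      refine hρ _ ?_
      by_cases hu : Q.coeff u = 0
      · simp [hu]
      · exact hQ (coeff_mem_coeffs _ hu)
  obtain ⟨A₂, hA₂⟩ := hlift A₁ fun y hy => by simp [hy]
  obtain ⟨N₂, hN₂⟩ := hlift N fun y hy => by simp [hy]
  have hN₂' : IsNormal N₂ := fun u hu => hN u fun h1 => hu (by
    have := congrArg (fun p => p.coeff u) hN₂
    simp only [coeff_map, coeff_C_mul, h1, mul_zero] at this
    exact Subtype.val_injective this)
  have hdet : map HahnO.subtype (detPoly HahnO - C e) = detPoly HahnK - C (e : HahnK) := by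
    rw [map_sub, map_detPoly, map_C]; rfl
  have hdet' : map res (detPoly HahnO - C e) = detPoly ℂ := by
    rw [map_sub, map_detPoly, map_C, he, C_0, sub_zero]
  have heq : C (tpow ρ) * map HahnO.subtype H =
      map HahnO.subtype (A₂ * (detPoly HahnO - C e) + N₂ * F) := by
    rw [map_add, map_mul, map_mul, hdet, hA₂, hN₂, h']
    ring
  -- If `ρ > 0`, the scaled left side reduces to `0`, so both scaled cofactors reduce to `0`,
  -- against the choice of `x`. If `ρ ≤ 0`, multiplying back by the integral `tpow (-ρ)` gives an
  -- integral representation that can be reduced.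
  rcases lt_or_ge 0 ρ with hpos | hneg
  · exfalso
    have e1 : C ⟨tpow ρ, tpow_mem hpos.le⟩ * H = A₂ * (detPoly HahnO - C e) + N₂ * F :=
      mvMap_subtype_injective (by rw [← heq, map_mul, map_C]; rfl)
    have e2 : res ⟨tpow ρ, tpow_mem hpos.le⟩ = 0 := HahnSeries.coeff_single_of_ne hpos.ne
    have e3 := congrArg (map res) e1
    rw [map_mul, map_C, e2, C_0, zero_mul, map_add, map_mul, map_mul, hdet'] at e3
    obtain ⟨hA0, hN0⟩ := normal_syzygy hF (hN₂'.map res) e3.symm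
    have hz : ∀ (Q : MvPolynomial (Fin 4) HahnK) (Q' : MvPolynomial (Fin 4) HahnO),
        map HahnO.subtype Q' = C (tpow ρ) * Q → map res Q' = 0 → x ∉ Q.coeffs := by
      intro Q Q' hQ hQ' hxQ
      obtain ⟨u, -, rfl⟩ := mem_coeffs_iff.1 hxQ
      apply hx0
      have e4 := congrArg (fun p => p.coeff u) hQ
      rw [coeff_map, coeff_C_mul] at e4
      have e5 := congrArg (fun p => p.coeff u) hQ'
      rw [coeff_map, res_apply, coeff_zero] at e5
      rw [← e4]
      exact e5
    rw [Finset.mem_insert, Finset.mem_union] at hx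
    rcases hx with rfl | hx | hx
    · simp at hx0
    · exact hz _ _ hA₂ hA0 hx
    · exact hz _ _ hN₂ hN0 hx
  · have e1 : H = C ⟨tpow (-ρ), tpow_mem (by linarith)⟩ *
        (A₂ * (detPoly HahnO - C e) + N₂ * F) := by
      apply mvMap_subtype_injective
      rw [map_mul, ← heq, map_C, ← mul_assoc, ← C_mul]
      change _ = C (tpow (-ρ) * tpow ρ) * _
      rw [mul_comm (tpow (-ρ)), tpow_mul_neg, C_1, one_mul]
    rw [e1, map_mul, map_add, map_mul, map_mul, hdet']
    refine Ideal.mul_mem_left _ _ (Ideal.add_mem _ (Ideal.mul_mem_left _ _ ?_)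
      (Ideal.mul_mem_left _ _ ?_)) <;> exact Ideal.subset_span (by simp)

/-- The determinant `t ^ (-2α)` of `t ^ (-α) z` for `z` in `SL₂`. -/
def normDet {α : ℝ} (hα : 0 < α) : HahnO := ⟨tpow (2 * α), tpow_mem (by linarith)⟩

lemma res_normDet {α : ℝ} (hα : 0 < α) : res (normDet hα) = 0 :=
  HahnSeries.coeff_single_of_ne (by linarith)

lemma scaleVars_detPoly (α : ℝ) :
    C (tpow (2 * α)) * scaleVars α (detPoly HahnK) = detPoly HahnK := by
  have h : C (tpow (2 * α)) * C (tpow (-α)) * C (tpow (-α)) = (1 : MvPolynomial (Fin 4) HahnK) := by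
    rw [← C_mul, ← C_mul, ← tpow_add, ← tpow_add, ← C_1, ← tpow_zero]
    congr 2
    ring
  simp only [detPoly_eq, scaleVars, map_sub, map_mul, aeval_X]
  linear_combination (X 0 * X 3 - X 1 * X 2) * h

lemma isModel_detPoly_sub_one {α : ℝ} (hα : 0 < α) :
    IsModel α (2 * α) (detPoly HahnK - 1)
      (detPoly HahnO - C (normDet hα)) := by
  have h1 : map HahnO.subtype (detPoly HahnO - C (normDet hα)) =
      detPoly HahnK - C (tpow (2 * α)) := by
    rw [map_sub, map_detPoly, map_C]; rfl
  have h2 : scaleVars α (detPoly HahnK - 1) = scaleVars α (detPoly HahnK) - 1 := by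
    rw [map_sub, map_one]
  rw [IsModel, h1, h2]
  linear_combination -scaleVars_detPoly α

lemma map_res_detPoly_sub {α : ℝ} (hα : 0 < α) :
    map res (detPoly HahnO - C (normDet hα)) = detPoly ℂ := by
  rw [map_sub, map_detPoly, map_C, res_normDet, C_0, sub_zero]

lemma twist_detPoly (α : ℝ) :
    twist α (detPoly ℂ) = C (AddMonoidAlgebra.single (-(2 * α)) 1) * detPoly GrK := by
  have h : C (AddMonoidAlgebra.single (-α) 1) * C (AddMonoidAlgebra.single (-α) 1) =
      (C (AddMonoidAlgebra.single (-(2 * α)) 1) : MvPolynomial (Fin 4) GrK) := by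
    rw [← C_mul, AddMonoidAlgebra.single_mul_single, one_mul]
    congr 2
    ring
  simp [detPoly_eq, twist]
  linear_combination (X 0 * X 3 - X 1 * X 2) * h

lemma initPoly_detPoly_sub_one {α : ℝ} (hα : 0 < α) :
    initPoly α (detPoly HahnK - 1) = detPoly GrK := by
  have hm := isModel_detPoly_sub_one hα
  have ht := (hm.trop_eq (by rw [map_res_detPoly_sub hα]; exact detPoly_ne_zero)).2
  rw [hm.initPoly_eq ht, map_res_detPoly_sub hα, twist_detPoly, ← mul_assoc, ← C_mul,
    AddMonoidAlgebra.single_mul_single, add_neg_cancel, one_mul, ← AddMonoidAlgebra.one_def, C_1,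
    one_mul]

/-- Transports membership in the ideal of the surface into the shape required by `res_mem_span`. -/
lemma mul_scaleVars_eq {α τ σ : ℝ} {f a b : MvPolynomial (Fin 4) HahnK}
    {f' h' : MvPolynomial (Fin 4) HahnO} (hf : IsModel α τ f f')
    (hh : IsModel α σ (a * (detPoly HahnK - 1) + b * f) h') :
    map HahnO.subtype h' = C (tpow (σ - 2 * α)) * scaleVars α a *
      (detPoly HahnK - C (tpow (2 * α))) +
      C (tpow (σ - τ)) * scaleVars α b * map HahnO.subtype f' := by
  have h1 : C (tpow (σ - 2 * α)) * C (tpow (2 * α)) = (C (tpow σ) : MvPolynomial (Fin 4) HahnK) := by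
    rw [← C_mul, ← tpow_add, sub_add_cancel]
  have h2 : C (tpow (σ - τ)) * C (tpow τ) = (C (tpow σ) : MvPolynomial (Fin 4) HahnK) := by
    rw [← C_mul, ← tpow_add, sub_add_cancel]
  have h3 := scaleVars_detPoly α
  rw [hh, hf]
  simp only [map_add, map_mul, map_sub, map_one]
  linear_combination (-scaleVars α a * (scaleVars α (detPoly HahnK) - 1)) * h1 -
    scaleVars α b * scaleVars α f * h2 + C (tpow (σ - 2 * α)) * scaleVars α a * h3

theorem initIdeal_surfaceIdeal {α τ : ℝ} (hα : 0 < α) {f : MvPolynomial (Fin 4) HahnK}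
    {f' : MvPolynomial (Fin 4) HahnO} (hm : IsModel α τ f f') (hf : eval 1 (map res f') ≠ 0) :
    initIdeal α (surfaceIdeal f) = Ideal.span {detPoly GrK, initPoly α f} := by
  have hτ := (hm.trop_eq fun h => hf (by rw [h, map_zero])).2
  refine le_antisymm (Ideal.span_le.2 ?_) (Ideal.span_le.2 ?_)
  · rintro _ ⟨h, hh, rfl⟩
    obtain ⟨a, b, rfl⟩ := Ideal.mem_span_pair.1 hh
    by_cases h0 : a * (detPoly HahnK - 1) + b * f = 0
    · rw [h0]
      simp [initPoly]
    obtain ⟨σ, hσ⟩ := exists_trop_eq h0 α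
    obtain ⟨h', hh'⟩ := exists_model h0 hσ
    have hmem := res_mem_span hf (res_normDet hα) (mul_scaleVars_eq hm hh')
    obtain ⟨A, B, hAB⟩ := Ideal.mem_span_pair.1 hmem
    rw [SetLike.mem_coe, hh'.initPoly_eq hσ, ← hAB, map_add, map_mul, map_mul, twist_detPoly,
      hm.twist_eq hτ]
    refine Ideal.mul_mem_left _ _ (Ideal.add_mem _ (Ideal.mul_mem_left _ _ ?_)
      (Ideal.mul_mem_left _ _ ?_)) <;>
    exact Ideal.mul_mem_left _ _ (Ideal.subset_span (by simp))
  · rintro _ (rfl | rfl)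
    · rw [← initPoly_detPoly_sub_one hα]
      exact Ideal.subset_span ⟨_, Ideal.subset_span (by simp), rfl⟩
    · exact Ideal.subset_span ⟨_, Ideal.subset_span (by simp), rfl⟩

end InitialIdeal

/-! ### Tropical roots and critical levels -/

section Critical

open MvPolynomial

open Classical in
/-- The exponents of `f` at which `Trop(f) · α` is attained. -/
def maxSet (f : MvPolynomial (Fin 4) HahnK) (α : ℝ) : Finset (Fin 4 →₀ ℕ) :=
  {u ∈ f.support | termVal f α u = trop f α}

lemma mem_maxSet {f : MvPolynomial (Fin 4) HahnK} {α τ : ℝ} (hτ : trop f α = (τ : WithBot ℝ))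
    {u : Fin 4 →₀ ℕ} :
    u ∈ maxSet f α ↔ u ∈ f.support ∧ -(f.coeff u).order + α * u.degree = τ := by
  rw [maxSet, Finset.mem_filter]
  refine and_congr_right fun hu => ?_
  rw [hτ, termVal_eq hu, WithBot.coe_inj]

lemma maxSet_nonempty {f : MvPolynomial (Fin 4) HahnK} (hf : f ≠ 0) (α : ℝ) :
    (maxSet f α).Nonempty := by
  obtain ⟨τ, hτ⟩ := exists_trop_eq hf α
  obtain ⟨u, hu, e⟩ := ((trop_eq_iff hf).1 hτ).2
  exact ⟨u, (mem_maxSet hτ).2 ⟨hu, e⟩⟩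

lemma initPoly_eq_sum (α : ℝ) (f : MvPolynomial (Fin 4) HahnK) :
    initPoly α f = ∑ u ∈ maxSet f α, monomial u (initForm (f.coeff u)) := rfl

/-- The sums of the leading coefficients of `f` over sets of exponents do not vanish. -/
def IsGeneric (f : MvPolynomial (Fin 4) HahnK) : Prop :=
  ∀ S ⊆ f.support, S.Nonempty → ∑ u ∈ S, (f.coeff u).leadingCoeff ≠ 0

lemma IsModel.eval_one_ne_zero {α τ : ℝ} {f : MvPolynomial (Fin 4) HahnK}
    {f' : MvPolynomial (Fin 4) HahnO} (hm : IsModel α τ f f') (hf : f ≠ 0)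
    (hτ : trop f α = (τ : WithBot ℝ)) (hg : IsGeneric f) : eval 1 (map res f') ≠ 0 := by
  classical
  have e : map res f' = ∑ u ∈ maxSet f α, monomial u (f.coeff u).leadingCoeff := by
    ext1 u
    rw [hm.coeff_res hτ, coeff_sum]
    simp only [coeff_monomial, Finset.sum_ite_eq', maxSet, Finset.mem_filter]
  have h1 := hg (maxSet f α) (Finset.filter_subset _ _) (maxSet_nonempty hf α)
  rw [e, map_sum]
  simpa [eval_monomial, Finsupp.prod] using h1

/-- The maximal terms at `β` all have slope `d`, so they stay equal to each other nearby, and the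
finitely many other terms stay strictly below by continuity. -/
lemma eventually_maxSet_eq {f : MvPolynomial (Fin 4) HahnK} (hf : f ≠ 0) {β : ℝ} {d : ℕ}
    (hd : ∀ u ∈ maxSet f β, u.degree = d) :
    ∃ b : ℝ, ∀ᶠ α in 𝓝 β, trop f α = ((d * α + b : ℝ) : WithBot ℝ) ∧
      maxSet f α = maxSet f β := by
  obtain ⟨τ, hτ⟩ := exists_trop_eq hf β
  obtain ⟨hle, u₀, hu₀, e₀⟩ := (trop_eq_iff hf).1 hτ
  have hd₀ := hd u₀ ((mem_maxSet hτ).2 ⟨hu₀, e₀⟩)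
  have hev : ∀ᶠ α in 𝓝 β, ∀ u ∈ f.support, u ∉ maxSet f β →
      -(f.coeff u).order + α * u.degree < d * α + (τ - d * β) := by
    rw [Filter.eventually_all_finset]
    intro u hu
    by_cases hm : u ∈ maxSet f β
    · exact Filter.Eventually.of_forall fun α h => absurd hm h
    have hlt : -(f.coeff u).order + β * u.degree < d * β + (τ - d * β) := by
      rw [add_sub_cancel]
      exact lt_of_le_of_ne (hle u hu) fun e => hm ((mem_maxSet hτ).2 ⟨hu, e⟩)
    have c1 : Continuous fun α : ℝ => -(f.coeff u).order + α * u.degree := by fun_prop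
    have c2 : Continuous fun α : ℝ => d * α + (τ - d * β) := by fun_prop
    exact (c1.continuousAt.eventually_lt c2.continuousAt hlt).mono fun α h _ => h
  refine ⟨τ - d * β, hev.mono fun α hα => ?_⟩
  have heq : ∀ u ∈ maxSet f β, -(f.coeff u).order + α * u.degree = d * α + (τ - d * β) := by
    intro u hu
    have h1 := ((mem_maxSet hτ).1 hu).2
    rw [hd u hu] at h1 ⊢
    linarith
  have htr : trop f α = ((d * α + (τ - d * β) : ℝ) : WithBot ℝ) := by
    refine (trop_eq_iff hf).2 ⟨fun u hu => ?_, u₀, hu₀, heq u₀ ((mem_maxSet hτ).2 ⟨hu₀, e₀⟩)⟩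
    by_cases hm : u ∈ maxSet f β
    · exact (heq u hm).le
    · exact (hα u hu hm).le
  refine ⟨htr, ?_⟩
  ext u
  rw [mem_maxSet htr]
  refine ⟨fun h => ?_, fun h => ⟨((mem_maxSet hτ).1 h).1, heq u h⟩⟩
  by_contra hm
  exact (hα u h.1 hm).ne h.2

/-- If the slope near `β` is `m`, comparison to the left of `β` gives `m ≤ deg u`, and to the right
`deg v ≤ m`. -/
lemma degree_le_of_not_isTropicalRoot {f : MvPolynomial (Fin 4) HahnK} (hf : f ≠ 0) {β : ℝ}
    (hr : ¬ IsTropicalRoot f β) {u v : Fin 4 →₀ ℕ} (hu : u ∈ maxSet f β) (hv : v ∈ maxSet f β) :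
    v.degree ≤ u.degree := by
  obtain ⟨m, b, hmb⟩ := not_not.1 fun h => hr ⟨hf, h⟩
  obtain ⟨ε, hε, hball⟩ := Metric.eventually_nhds_iff.1 hmb
  have hτ := hball (y := β) (by simpa using hε)
  have h1 := hball (y := β - ε / 2) (by rw [Real.dist_eq, abs_lt]; constructor <;> linarith)
  have h2 := hball (y := β + ε / 2) (by rw [Real.dist_eq, abs_lt]; constructor <;> linarith)
  obtain ⟨hu, eu⟩ := (mem_maxSet hτ).1 hu
  obtain ⟨hv, ev⟩ := (mem_maxSet hτ).1 hv
  have l1 := ((trop_eq_iff hf).1 h1).1 u hu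
  have l2 := ((trop_eq_iff hf).1 h2).1 v hv
  have k1 : m * (ε / 2) ≤ u.degree * (ε / 2) := by linarith
  have k2 : v.degree * (ε / 2) ≤ m * (ε / 2) := by linarith
  have := le_of_mul_le_mul_right (k2.trans k1) (by linarith : 0 < ε / 2)
  exact_mod_cast this

lemma isTropicalRoot_iff {f : MvPolynomial (Fin 4) HahnK} (hf : f ≠ 0) {β : ℝ} :
    IsTropicalRoot f β ↔ ∃ u ∈ maxSet f β, ∃ v ∈ maxSet f β, u.degree ≠ v.degree := by
  constructor
  · intro hr
    by_contra! h
    obtain ⟨u₀, hu₀⟩ := maxSet_nonempty hf β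
    obtain ⟨b, hb⟩ := eventually_maxSet_eq hf fun u hu => h u hu u₀ hu₀
    exact hr.2 ⟨_, b, hb.mono fun α h => h.1⟩
  · rintro ⟨u, hu, v, hv, hne⟩
    by_contra hr
    exact hne (le_antisymm (degree_le_of_not_isTropicalRoot hf hr hv hu)
      (degree_le_of_not_isTropicalRoot hf hr hu hv))

section Homogeneous

attribute [local instance] MvPolynomial.gradedAlgebra

lemma isHomogeneousIdeal_span {s : Set (MvPolynomial (Fin 4) GrK)}
    (hs : ∀ F ∈ s, ∃ d, F.IsHomogeneous d) : IsHomogeneousIdeal (Ideal.span s) := by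
  have h : (Ideal.span s).IsHomogeneous (homogeneousSubmodule (Fin 4) GrK) :=
    Ideal.homogeneous_span _ _ fun F hF => by
      obtain ⟨d, hd⟩ := hs F hF
      exact ⟨d, (mem_homogeneousSubmodule d F).2 hd⟩
  exact fun F hF => (mem_iff_homogeneousComponent_mem h F).1 hF

end Homogeneous

lemma isHomogeneous_detPoly : (detPoly GrK).IsHomogeneous 2 := by
  rw [detPoly_eq]
  exact ((isHomogeneous_X _ _).mul (isHomogeneous_X _ _)).sub
    ((isHomogeneous_X _ _).mul (isHomogeneous_X _ _))

lemma isHomogeneous_initPoly {f : MvPolynomial (Fin 4) HahnK} {α : ℝ} {d : ℕ}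
    (hd : ∀ u ∈ maxSet f α, u.degree = d) : (initPoly α f).IsHomogeneous d :=
  IsHomogeneous.sum _ _ _ fun u hu => isHomogeneous_monomial _ (hd u hu)

/-! ### Detecting inhomogeneity on the line of the all-ones matrix. -/

/-- The augmentation of `gr_ν(𝕂)`. -/
def augment : GrK →ₐ[ℂ] ℂ := AddMonoidAlgebra.lift ℂ ℂ ℝ 1

lemma augment_single (a : ℝ) (c : ℂ) : augment (AddMonoidAlgebra.single a c) = c := by
  simp [augment]

/-- Restriction of polynomials to the line spanned by the all-ones matrix. -/
def diag : MvPolynomial (Fin 4) GrK →+* Polynomial ℂ :=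
  eval₂Hom (Polynomial.C.comp augment.toRingHom) fun _ => Polynomial.X

lemma diag_monomial (u : Fin 4 →₀ ℕ) (c : GrK) :
    diag (monomial u c) = Polynomial.monomial u.degree (augment c) := by
  rw [diag, coe_eval₂Hom, eval₂_monomial, Finsupp.prod_fintype _ _ (by simp),
    Finset.prod_pow_eq_pow_sum, ← Finsupp.degree_eq_sum, ← Polynomial.C_mul_X_pow_eq_monomial]
  rfl

lemma diag_homogeneousComponent (F : MvPolynomial (Fin 4) GrK) (n : ℕ) :
    diag (homogeneousComponent n F) = Polynomial.monomial n ((diag F).coeff n) := by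
  induction F using MvPolynomial.induction_on' with
  | monomial u c =>
    rw [homogeneousComponent_of_mem ((mem_homogeneousSubmodule _ _).2
      (isHomogeneous_monomial c rfl)), diag_monomial, Polynomial.coeff_monomial]
    split_ifs with h1 h2 h2
    · rw [h1, diag_monomial]
    · exact absurd h1.symm h2
    · exact absurd h2.symm h1
    · simp
  | add p q hp hq => simp only [map_add, hp, hq, Polynomial.coeff_add]

lemma diag_detPoly : diag (detPoly GrK) = 0 := by
  simp [detPoly_eq, diag]

lemma coeff_diag_initPoly (f : MvPolynomial (Fin 4) HahnK) (α : ℝ) (n : ℕ) :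
    (diag (initPoly α f)).coeff n =
      ∑ u ∈ maxSet f α with u.degree = n, (f.coeff u).leadingCoeff := by
  rw [initPoly_eq_sum, map_sum, Polynomial.finsetSum_coeff, Finset.sum_filter]
  refine Finset.sum_congr rfl fun u _ => ?_
  rw [diag_monomial, Polynomial.coeff_monomial, initForm, augment_single]

lemma eq_of_dvd_monomial {G : Polynomial ℂ} {n m : ℕ} {c : ℂ} (hc : c ≠ 0)
    (h : G ∣ Polynomial.monomial n c) {k : ℕ} (hk : G.coeff k ≠ 0) (hm : G.coeff m ≠ 0) :
    k = m := by
  rw [← Polynomial.C_mul_X_pow_eq_monomial] at h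
  have hu : IsUnit (Polynomial.C c) := Polynomial.isUnit_C.2 hc.isUnit
  rw [hu.dvd_mul_left] at h
  obtain ⟨i, -, hi⟩ := (dvd_prime_pow Polynomial.prime_X n).1 h
  obtain ⟨w, hw⟩ := hi.symm
  obtain ⟨e, -, he⟩ := Polynomial.isUnit_iff.1 w.isUnit
  have key : ∀ j, G.coeff j ≠ 0 → j = i := fun j hj => by
    by_contra hne
    rw [← hw, ← he, mul_comm, Polynomial.coeff_C_mul_X_pow, if_neg hne] at hj
    exact hj rfl
  rw [key k hk, key m hm]

/-- At a tropical root, homogeneity would put one graded piece of `IN_β(f)` in the ideal. Applying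
`diag`, which kills `det`, makes the restriction of `IN_β(f)` divide a monomial; by genericity that
restriction has nonzero coefficients in two degrees, which is impossible. -/
lemma isCriticalLevel_iff {f : MvPolynomial (Fin 4) HahnK} (hf : f ≠ 0) (hg : IsGeneric f)
    {β : ℝ} (hβ : 0 < β) : IsCriticalLevel (surfaceIdeal f) β ↔ IsTropicalRoot f β := by
  have hI : ∀ α : ℝ, 0 < α →
      initIdeal α (surfaceIdeal f) = Ideal.span {detPoly GrK, initPoly α f} := fun α hα => by
    obtain ⟨τ, hτ⟩ := exists_trop_eq hf α
    obtain ⟨f', hm⟩ := exists_model hf hτ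
    exact initIdeal_surfaceIdeal hα hm (hm.eval_one_ne_zero hf hτ hg)
  rw [isTropicalRoot_iff hf, IsCriticalLevel, ← not_iff_not, not_not]
  constructor
  · rintro ⟨ε, hε, h⟩ ⟨u, hu, v, hv, hne⟩
    have hhom := (h β ⟨by linarith, by linarith⟩).2
    rw [hI β hβ] at hhom
    have hcoeff : ∀ w ∈ maxSet f β, (diag (initPoly β f)).coeff w.degree ≠ 0 := fun w hw => by
      rw [coeff_diag_initPoly]
      exact hg _ ((Finset.filter_subset _ _).trans (Finset.filter_subset _ _))
        ⟨w, Finset.mem_filter.2 ⟨hw, rfl⟩⟩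
    have hmem := hhom _ (Ideal.subset_span (by simp : initPoly β f ∈ _)) u.degree
    obtain ⟨A, B, hAB⟩ := Ideal.mem_span_pair.1 hmem
    have hdvd := congrArg diag hAB
    rw [map_add, map_mul, map_mul, diag_detPoly, mul_zero, zero_add,
      diag_homogeneousComponent] at hdvd
    exact hne (eq_of_dvd_monomial (hcoeff u hu) (Dvd.intro_left _ hdvd) (hcoeff u hu)
      (hcoeff v hv))
  · intro h
    push Not at h
    obtain ⟨u₀, hu₀⟩ := maxSet_nonempty hf β
    have hd : ∀ u ∈ maxSet f β, u.degree = u₀.degree := fun u hu => h u hu u₀ hu₀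
    obtain ⟨b, hb⟩ := eventually_maxSet_eq hf hd
    obtain ⟨ε, hε, hball⟩ := Metric.eventually_nhds_iff.1 (hb.and (lt_mem_nhds hβ))
    refine ⟨ε, hε, fun α hα => ?_⟩
    obtain ⟨⟨-, hmax⟩, hα0⟩ := hball (y := α)
      (by rw [Real.dist_eq, abs_lt]; constructor <;> linarith [hα.1, hα.2])
    have hin : initPoly α f = initPoly β f := by rw [initPoly_eq_sum, initPoly_eq_sum, hmax]
    rw [hI α hα0, hI β hβ, hin]
    refine ⟨rfl, isHomogeneousIdeal_span ?_⟩
    rintro _ (rfl | rfl)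
    · exact ⟨2, isHomogeneous_detPoly⟩
    · exact ⟨_, isHomogeneous_initPoly hd⟩

end Critical

/-! ### Level sets of the phase tropicalization -/

section Level

open MvPolynomial

/-- `P` is the product, over all nonempty subsets of `U`, of the sums of the corresponding
variables. -/
lemma exists_generic (U : Finset (Fin 4 →₀ ℕ)) :
    ∃ P : MvPolynomial U ℂ, P ≠ 0 ∧ ∀ c : (Fin 4 →₀ ℕ) → ℂ,
      eval (fun u : U => c u.1) P ≠ 0 → ∀ S ⊆ U, S.Nonempty → ∑ u ∈ S, c u ≠ 0 := by
  classical
  refine ⟨∏ S : Finset U with S.Nonempty, ∑ u ∈ S, X u, ?_, fun c hc S hS hne => ?_⟩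
  · rw [Finset.prod_ne_zero_iff]
    intro S hS h0
    obtain ⟨u, hu⟩ := (Finset.mem_filter.1 hS).2
    have := congrArg (eval (Pi.single u 1)) h0
    simp [map_sum, Pi.single_apply, hu] at this
  · rw [map_prod, Finset.prod_ne_zero_iff] at hc
    have h1 := hc (S.subtype (· ∈ U)) (by
      obtain ⟨u, hu⟩ := hne
      exact Finset.mem_filter.2 ⟨Finset.mem_univ _, ⟨u, hS hu⟩, by simpa using hu⟩)
    simp only [map_sum, eval_X] at h1
    rwa [Finset.sum_subtype_of_mem c fun u hu => hS hu] at h1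

lemma nu_le_iff {c : HahnK} {α : ℝ} : nu c ≤ (α : WithBot ℝ) ↔ tpow α * c ∈ HahnO := by
  rw [nu]
  split_ifs with hc
  · simp [hc, HahnO.zero_mem]
  rw [WithBot.coe_le_coe]
  refine ⟨fun h => tpow_mul_mem (Or.inr (by linarith)), fun h => ?_⟩
  by_contra! hlt
  exact hc (HahnSeries.coeff_order_eq_zero.1 (tpow_mul_mem_iff.1 h _ (by linarith)))

lemma nu_eq_iff {c : HahnK} {α : ℝ} :
    nu c = (α : WithBot ℝ) ↔ tpow α * c ∈ HahnO ∧ c.coeff (-α) ≠ 0 := by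
  constructor
  · intro h
    refine ⟨nu_le_iff.1 h.le, ?_⟩
    rw [nu] at h
    split_ifs at h with hc
    · exact absurd h (by simp)
    · rw [WithBot.coe_inj] at h
      rw [← h, neg_neg]
      exact mt HahnSeries.coeff_order_eq_zero.1 hc
  · rintro ⟨h1, h2⟩
    refine le_antisymm (nu_le_iff.2 h1) ?_
    rw [nu, if_neg (HahnSeries.ne_zero_of_coeff_ne_zero h2), WithBot.coe_le_coe]
    linarith [HahnSeries.order_le_of_coeff_ne_zero h2]

/-- Turns phases into reductions: a point of level `α` and phase `θ` is `t^α` times an integral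
vector reducing to `θ ≠ 0`. -/
lemma phase_eq_iff {z : Fin 4 → HahnK} {α : ℝ} {θ : Fin 4 → ℂ} :
    z ≠ 0 ∧ phase z = (α, θ) ↔
      θ ≠ 0 ∧ ∃ w : Fin 4 → HahnO, (∀ i, z i = tpow (-α) * w i) ∧ ∀ i, res (w i) = θ i := by
  constructor
  · rintro ⟨hz, hp⟩
    obtain ⟨i₀, hi₀⟩ := Function.ne_iff.1 hz
    obtain ⟨j, -, hj⟩ := Finset.exists_mem_eq_sup Finset.univ ⟨i₀, Finset.mem_univ _⟩
      fun i => nu (z i)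
    change maxVal z = _ at hj
    have hle : ∀ i, nu (z i) ≤ maxVal z := fun i =>
      Finset.le_sup (f := fun i => nu (z i)) (Finset.mem_univ i)
    have hbot : maxVal z ≠ ⊥ := fun h => by
      have := hle i₀
      rw [h, nu, if_neg (show z i₀ ≠ 0 from hi₀)] at this
      simp at this
    obtain ⟨a, ha⟩ := WithBot.ne_bot_iff_exists.1 hbot
    simp only [phase, Prod.mk.injEq, ← ha, WithBot.unbotD_coe] at hp
    obtain ⟨rfl, rfl⟩ := hp
    refine ⟨fun h => ?_, fun i => ⟨tpow a * z i, nu_le_iff.1 (ha ▸ hle i)⟩, fun i => ?_,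
      fun i => ?_⟩
    · exact (nu_eq_iff.1 (ha.trans hj).symm).2 (congrFun h j)
    · rw [← mul_assoc, mul_comm (tpow (-a)), tpow_mul_neg, one_mul]
    · rw [res_apply, coeff_tpow_mul, zero_sub]
  · rintro ⟨hθ, w, hz, hw⟩
    have hw' : ∀ i, tpow α * z i = w i := fun i => by
      rw [hz, ← mul_assoc, tpow_mul_neg, one_mul]
    have hθz : ∀ i, (z i).coeff (-α) = θ i := fun i => by
      rw [← hw, res_apply, ← hw', coeff_tpow_mul, zero_sub]
    obtain ⟨j, hj⟩ := Function.ne_iff.1 hθ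
    have hmax : maxVal z = (α : WithBot ℝ) := by
      refine le_antisymm (Finset.sup_le fun i _ => nu_le_iff.2 (by rw [hw']; exact (w i).2)) ?_
      rw [← nu_eq_iff.2 ⟨by rw [hw']; exact (w j).2, by rw [hθz]; exact hj⟩]
      exact Finset.le_sup (f := fun i => nu (z i)) (Finset.mem_univ j)
    refine ⟨fun h => hj ?_, ?_⟩
    · rw [← hθz, h]; simp
    · simp only [phase, hmax, WithBot.unbotD_coe, hθz]

lemma IsModel.eval_eq {α τ : ℝ} {h : MvPolynomial (Fin 4) HahnK}
    {h' : MvPolynomial (Fin 4) HahnO} (hm : IsModel α τ h h') (w : Fin 4 → HahnO) :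
    ((eval w h' : HahnO) : HahnK) = tpow τ * eval (fun i => tpow (-α) * (w i : HahnK)) h := by
  have h1 : ((eval w h' : HahnO) : HahnK) =
      eval (fun i => (w i : HahnK)) (map HahnO.subtype h') := by
    rw [eval_map]
    exact (eval₂_comp_left HahnO.subtype (RingHom.id _) w h').trans (by rfl)
  have h2 : ∀ p, eval (fun i => (w i : HahnK)) (scaleVars α p) =
      eval (fun i => tpow (-α) * (w i : HahnK)) p := fun p => by
    have : (eval fun i => (w i : HahnK)).comp (scaleVars α).toRingHom =
        eval fun i => tpow (-α) * (w i : HahnK) := by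
      apply MvPolynomial.ringHom_ext
      · intro r; simp [scaleVars]
      · intro i; simp [scaleVars]
    exact congrArg (fun φ => φ p) this
  rw [h1, hm, map_mul, eval_C, h2]

lemma IsModel.eval_eq_zero_iff {α τ : ℝ} {h : MvPolynomial (Fin 4) HahnK}
    {h' : MvPolynomial (Fin 4) HahnO} (hm : IsModel α τ h h') (w : Fin 4 → HahnO) :
    eval w h' = 0 ↔ eval (fun i => tpow (-α) * (w i : HahnK)) h = 0 := by
  rw [← Subtype.val_injective.eq_iff]
  change ((eval w h' : HahnO) : HahnK) = 0 ↔ _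
  rw [hm.eval_eq, mul_eq_zero, or_iff_right (tpow_ne_zero τ)]

lemma res_eval (w : Fin 4 → HahnO) (p : MvPolynomial (Fin 4) HahnO) :
    res (eval w p) = eval (fun i => res (w i)) (map res p) := by
  rw [eval_map]
  exact eval₂_comp_left res (RingHom.id _) w p

lemma eval_twist (α : ℝ) (θ : Fin 4 → ℂ) (p : MvPolynomial (Fin 4) ℂ) :
    eval (fun i => AddMonoidAlgebra.single α (θ i)) (twist α p) =
      algebraMap ℂ GrK (eval θ p) := by
  have : (eval fun i => (AddMonoidAlgebra.single α (θ i) : GrK)).comp (twist α) =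
      (algebraMap ℂ GrK).comp (eval θ) := by
    apply MvPolynomial.ringHom_ext
    · intro r; simp [twist]
    · intro i; simp [twist, AddMonoidAlgebra.single_mul_single]
  exact congrArg (fun φ => φ p) this

lemma IsModel.eval_initPoly_eq_zero_iff {α τ : ℝ} {h : MvPolynomial (Fin 4) HahnK}
    {h' : MvPolynomial (Fin 4) HahnO} (hm : IsModel α τ h h') (hr : map res h' ≠ 0)
    (θ : Fin 4 → ℂ) :
    eval (fun i => AddMonoidAlgebra.single α (θ i)) (initPoly α h) = 0 ↔
      eval θ (map res h') = 0 := by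
  rw [hm.initPoly_eq (hm.trop_eq hr).2, map_mul, eval_C, eval_twist]
  simp [AddMonoidAlgebra.single_mul_single]

lemma exists_rank_one {θ : Fin 4 → ℂ} (hdet : eval θ (detPoly ℂ) = 0) :
    ∃ p₀ p₁ r₀ r₁ : ℂ, θ = ![p₀ * r₀, p₀ * r₁, p₁ * r₀, p₁ * r₁] := by
  have hd : θ 0 * θ 3 = θ 1 * θ 2 := by
    simpa [detPoly_eq, sub_eq_zero] using hdet
  by_cases h0 : θ 0 = 0
  · by_cases h1 : θ 1 = 0
    · refine ⟨0, 1, θ 2, θ 3, ?_⟩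
      ext i; fin_cases i <;> simp [h0, h1]
    · refine ⟨1, θ 3 / θ 1, θ 0, θ 1, ?_⟩
      have h2 : θ 2 = 0 := by
        rw [h0, zero_mul] at hd
        exact (mul_eq_zero.1 hd.symm).resolve_left h1
      ext i; fin_cases i <;> simp [h0, h1, h2]
  · refine ⟨1, θ 2 / θ 0, θ 0, θ 1, ?_⟩
    ext i; fin_cases i <;> simp [h0]
    field_simp
    linear_combination hd

lemma linear_ne_zero {p q : ℂ} (h : p ≠ 0 ∨ q ≠ 0) {i j : Fin 4} (hij : i ≠ j) :
    (C p * X i - C q * X j : MvPolynomial (Fin 4) ℂ) ≠ 0 := by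
  intro e
  have h1 := congrArg (eval (Pi.single i 1)) e
  have h2 := congrArg (eval (Pi.single j 1)) e
  simp [hij, hij.symm] at h1 h2
  exact h.elim (fun h => h h1) fun h => h h2

/-- Constants of the valuation ring. -/
def constO : ℂ →+* HahnO :=
  (HahnSeries.C : ℂ →+* HahnK).codRestrict HahnO fun _ _ hx =>
    HahnSeries.coeff_single_of_ne hx.ne

lemma res_constO (c : ℂ) : res (constO c) = c := HahnSeries.coeff_single_same 0 c

lemma eval_aeval_polynomial (W : Fin 4 → Polynomial HahnO) (F : MvPolynomial (Fin 4) HahnO)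
    (s : HahnO) : (aeval W F).eval s = eval (fun i => (W i).eval s) F := by
  have : (Polynomial.evalRingHom s).comp (aeval W : _ →ₐ[HahnO] Polynomial HahnO).toRingHom =
      eval fun i => (W i).eval s := by
    apply MvPolynomial.ringHom_ext
    · intro r; simp
    · intro i; simp
  exact congrArg (fun φ => φ F) this

lemma eval_map_res_aeval (W : Fin 4 → Polynomial HahnO) (F : MvPolynomial (Fin 4) HahnO)
    (s : ℂ) : ((aeval W F).map res).eval s =
      eval (fun i => ((W i).map res).eval s) (map res F) := by
  have : ((Polynomial.evalRingHom s).comp (Polynomial.mapRingHom res)).comp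
      (aeval W : _ →ₐ[HahnO] Polynomial HahnO).toRingHom =
      (eval fun i => ((W i).map res).eval s).comp (map res) := by
    apply MvPolynomial.ringHom_ext
    · intro r; simp
    · intro i; simp
  exact congrArg (fun φ => φ F) this

lemma line_mul_sub {R : Type*} [CommRing R] {a₀ a₁ d₀ d₁ q₀ q₁ x : R}
    (h₁ : a₀ * q₁ - a₁ * q₀ = 1) (h₂ : d₀ * q₁ - d₁ * q₀ = 0) :
    (a₀ + d₀ * x) * q₁ - (a₁ + d₁ * x) * q₀ = 1 := by
  linear_combination h₁ + x * h₂

/-- For column vectors this is `det(p rᵀ + e q sᵀ) = e det(p, q) det(r, s)`. -/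
lemma det_rank_one_add {R : Type*} [CommRing R] {p₀ p₁ q₀ q₁ r₀ r₁ s₀ s₁ e : R}
    (h₁ : p₀ * q₁ - p₁ * q₀ = 1) (h₂ : r₀ * s₁ - r₁ * s₀ = 1) :
    (p₀ * r₀ + e * (q₀ * s₀)) * (p₁ * r₁ + e * (q₁ * s₁)) -
      (p₀ * r₁ + e * (q₀ * s₁)) * (p₁ * r₀ + e * (q₁ * s₀)) = e := by
  linear_combination e * (r₀ * s₁ - r₁ * s₀) * h₁ + e * h₂

/-- Writing `θ = p rᵀ`, the vectors `p` and `r` are moved along lines to a generic rank-one matrix,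
with a correction of size `e` keeping the determinant equal to `e`. On this curve `F` is a
one-variable polynomial with nonzero reduction vanishing at the start, so it has a root in the
maximal ideal. -/
lemma exists_lift_point {F : MvPolynomial (Fin 4) HahnO} (hF : eval 1 (map res F) ≠ 0)
    {e : HahnO} (he : res e = 0) {θ : Fin 4 → ℂ} (hθ : θ ≠ 0) (hdet : eval θ (detPoly ℂ) = 0)
    (hFθ : eval θ (map res F) = 0) :
    ∃ w : Fin 4 → HahnO, (∀ i, res (w i) = θ i) ∧ eval w (detPoly HahnO - C e) = 0 ∧
      eval w F = 0 := by
  obtain ⟨p₀, p₁, r₀, r₁, hpr⟩ := exists_rank_one hdet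
  have hp : p₀ ≠ 0 ∨ p₁ ≠ 0 := by
    by_contra! h
    apply hθ; rw [hpr, h.1, h.2]
    ext i; fin_cases i <;> simp
  have hr : r₀ ≠ 0 ∨ r₁ ≠ 0 := by
    by_contra! h
    apply hθ; rw [hpr, h.1, h.2]
    ext i; fin_cases i <;> simp
  -- The endpoint must avoid the zeros of the reduction of `F` and be linearly independent of `p`
  -- and of `r` in the two factors; a nonzero product of polynomials allows this.
  obtain ⟨x, hx⟩ : ∃ x : Fin 4 → ℂ, eval x (segre (map res F) *
      ((C p₀ * X 1 - C p₁ * X 0) * (C r₀ * X 3 - C r₁ * X 2))) ≠ 0 := by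
    by_contra! h
    refine mul_ne_zero (segre_ne_zero hF) (mul_ne_zero
      (linear_ne_zero (i := 1) (j := 0) hp (by decide))
      (linear_ne_zero (i := 3) (j := 2) hr (by decide))) (MvPolynomial.funext fun x => ?_)
    rw [h x, map_zero]
  simp only [map_mul, map_sub, eval_C, eval_X, eval_segre, mul_ne_zero_iff] at hx
  obtain ⟨hx, hδ, hη⟩ := hx
  set δ := p₀ * x 1 - p₁ * x 0 with hδdef
  set η := r₀ * x 3 - r₁ * x 2 with hηdef
  -- the lines through `p` and `r` in the directions `x - p` and `x - r`
  let L : ℂ → ℂ → Polynomial HahnO := fun a b =>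
    Polynomial.C (constO a) + Polynomial.C (constO (b - a)) * Polynomial.X
  let D : ℂ → ℂ → ℂ → Polynomial HahnO := fun a b d => Polynomial.C (constO ((b - a) / d))
  -- `D` is the direction of the line divided by `δ` or `η`. Moving along the line does not change
  -- the determinant of `L` with its own direction, so `L` and `D` have determinant `1` for every
  -- parameter.
  let E : Polynomial HahnO := Polynomial.C e
  let W : Fin 4 → Polynomial HahnO := ![
    L p₀ (x 0) * L r₀ (x 2) + E * (D p₀ (x 0) δ * D r₀ (x 2) η),
    L p₀ (x 0) * L r₁ (x 3) + E * (D p₀ (x 0) δ * D r₁ (x 3) η),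
    L p₁ (x 1) * L r₀ (x 2) + E * (D p₁ (x 1) δ * D r₀ (x 2) η),
    L p₁ (x 1) * L r₁ (x 3) + E * (D p₁ (x 1) δ * D r₁ (x 3) η)]
  have hLD : ∀ a₀ a₁ b₀ b₁ d : ℂ, d = a₀ * b₁ - a₁ * b₀ → d ≠ 0 →
      L a₀ b₀ * D a₁ b₁ d - L a₁ b₁ * D a₀ b₀ d = 1 := by
    intro a₀ a₁ b₀ b₁ d hd hd0
    have e1 : a₀ * ((b₁ - a₁) / d) - a₁ * ((b₀ - a₀) / d) = 1 := by
      field_simp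
      rw [hd]; ring
    have e2 : (b₀ - a₀) * ((b₁ - a₁) / d) - (b₁ - a₁) * ((b₀ - a₀) / d) = 0 := by ring
    have e1' := congrArg (fun c => Polynomial.C (constO c)) e1
    have e2' := congrArg (fun c => Polynomial.C (constO c)) e2
    simp only [map_sub, map_mul, map_one, map_zero] at e1' e2'
    simp only [L, D, map_sub]
    exact line_mul_sub (R := Polynomial HahnO) e1' e2'
  have hWdet : W 0 * W 3 - W 1 * W 2 = E := by
    have k1 := hLD p₀ p₁ (x 0) (x 1) δ hδdef hδ
    have k2 := hLD r₀ r₁ (x 2) (x 3) η hηdef hη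
    change (L p₀ (x 0) * L r₀ (x 2) + E * (D p₀ (x 0) δ * D r₀ (x 2) η)) *
      (L p₁ (x 1) * L r₁ (x 3) + E * (D p₁ (x 1) δ * D r₁ (x 3) η)) -
      (L p₀ (x 0) * L r₁ (x 3) + E * (D p₀ (x 0) δ * D r₁ (x 3) η)) *
      (L p₁ (x 1) * L r₀ (x 2) + E * (D p₁ (x 1) δ * D r₀ (x 2) η)) = E
    exact det_rank_one_add (R := Polynomial HahnO) k1 k2
  have hres : ∀ s : ℂ, (fun i => ((W i).map res).eval s) =
      ![(p₀ + (x 0 - p₀) * s) * (r₀ + (x 2 - r₀) * s), (p₀ + (x 0 - p₀) * s) *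
        (r₁ + (x 3 - r₁) * s), (p₁ + (x 1 - p₁) * s) * (r₀ + (x 2 - r₀) * s),
        (p₁ + (x 1 - p₁) * s) * (r₁ + (x 3 - r₁) * s)] := by
    intro s
    ext i
    fin_cases i <;> simp [W, L, E, he, res_constO]
  have h0 : (fun i => ((W i).map res).eval 0) = θ := by
    rw [hres, hpr]; simp
  have h1 : (fun i => ((W i).map res).eval 1) =
      ![x 0 * x 2, x 0 * x 3, x 1 * x 2, x 1 * x 3] := by
    rw [hres]; simp
  -- The value at parameter `1` shows that the reduction is nonzero; the value at `0` is that at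
  -- `θ`.
  obtain ⟨s, hs, hroot⟩ := exists_root_residue_zero (q := aeval W F)
    (fun h => by
      have := eval_map_res_aeval W F 1
      rw [h, Polynomial.eval_zero, h1] at this
      exact hx this.symm)
    (by rw [eval_map_res_aeval, h0, hFθ])
  refine ⟨fun i => (W i).eval s, fun i => ?_, ?_, ?_⟩
  · rw [← Polynomial.eval_map_apply, hs, ← h0]
  · have := congrArg (Polynomial.eval s) hWdet
    simp only [Polynomial.eval_sub, Polynomial.eval_mul, E, Polynomial.eval_C] at this
    simp only [detPoly_eq, map_sub, map_mul, eval_X, eval_C, this, sub_self]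
  · rw [← eval_aeval_polynomial, hroot]

lemma mem_surface_iff {f : MvPolynomial (Fin 4) HahnK} {z : Fin 4 → HahnK} :
    z ∈ surface f ↔ eval z (detPoly HahnK - 1) = 0 ∧ eval z f = 0 := by
  rw [surface, mem_zeroLocus_iff]
  simp only [aeval_eq_eval]
  constructor
  · exact fun h => ⟨h _ (Ideal.subset_span (by simp)), h _ (Ideal.subset_span (by simp))⟩
  · rintro ⟨h1, h2⟩ p hp
    obtain ⟨a, b, rfl⟩ := Ideal.mem_span_pair.1 hp
    simp only [map_add, map_mul] at *
    rw [h1, h2, mul_zero, mul_zero, add_zero]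

theorem phaseTropLevel_surface {α τ : ℝ} (hα : 0 < α) {f : MvPolynomial (Fin 4) HahnK}
    {f' : MvPolynomial (Fin 4) HahnO} (hm : IsModel α τ f f') (hf : eval 1 (map res f') ≠ 0) :
    phaseTropLevel (surface f) α = zerosAt α {detPoly GrK, initPoly α f} \ {0} := by
  have hd := isModel_detPoly_sub_one hα
  have hdres := map_res_detPoly_sub hα
  have hf0 : map res f' ≠ 0 := fun h => hf (by rw [h, map_zero])
  have hzeros : ∀ θ : Fin 4 → ℂ, θ ∈ zerosAt α {detPoly GrK, initPoly α f} ↔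
      eval θ (detPoly ℂ) = 0 ∧ eval θ (map res f') = 0 := fun θ => by
    rw [← hm.eval_initPoly_eq_zero_iff hf0, ← hdres,
      ← hd.eval_initPoly_eq_zero_iff (by rw [hdres]; exact detPoly_ne_zero),
      initPoly_detPoly_sub_one hα]
    simp [zerosAt]
  ext θ
  rw [Set.mem_sdiff, hzeros, Set.mem_singleton_iff]
  constructor
  · rintro ⟨z, ⟨hzX, hz0⟩, hzp⟩
    obtain ⟨hθ, w, hzw, hw⟩ := phase_eq_iff.1 ⟨hz0, hzp⟩
    have hz : z = fun i => tpow (-α) * (w i : HahnK) := _root_.funext hzw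
    have hwθ : (fun i => res (w i)) = θ := _root_.funext hw
    rw [mem_surface_iff, hz, ← hd.eval_eq_zero_iff, ← hm.eval_eq_zero_iff] at hzX
    refine ⟨⟨?_, ?_⟩, hθ⟩
    · rw [← hdres, ← hwθ, ← res_eval, hzX.1, map_zero]
    · rw [← hwθ, ← res_eval, hzX.2, map_zero]
  · rintro ⟨⟨h1, h2⟩, hθ⟩
    obtain ⟨w, hw, hwd, hwf⟩ := exists_lift_point hf (res_normDet hα) hθ h1 h2
    obtain ⟨hz0, hzp⟩ := phase_eq_iff.2 ⟨hθ, w, fun i => rfl, hw⟩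
    exact ⟨_, ⟨mem_surface_iff.2 ⟨(hd.eval_eq_zero_iff w).1 hwd, (hm.eval_eq_zero_iff w).1 hwf⟩,
      hz0⟩, hzp⟩

/-- Nullstellensatz over the algebraically closed field `𝕂`; primality makes the ideal radical. -/
lemma vanishingIdeal_surface {f : MvPolynomial (Fin 4) HahnK} (hf : (surfaceIdeal f).IsPrime) :
    vanishingIdeal HahnK (surface f) = surfaceIdeal f := by
  rw [surface, vanishingIdeal_zeroLocus_eq_radical, hf.radical]

end Level

end PhaseTrop

end

/-! ### The main theorem, with `P` taken from `exists_generic`. -/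

theorem mainTheorem6 (U : Finset (Fin 4 →₀ ℕ)) (hU : U.Nonempty) :
    ∃ P : MvPolynomial U ℂ, P ≠ 0 ∧
      ∀ f : MvPolynomial (Fin 4) PhaseTrop.HahnK, f.support = U →
        MvPolynomial.eval (fun u : U => (f.coeff u.1).leadingCoeff) P ≠ 0 →
        (PhaseTrop.surfaceIdeal f).IsPrime →
        (∀ β : ℝ, 0 < β →
          (PhaseTrop.IsCriticalLevel
              (MvPolynomial.vanishingIdeal PhaseTrop.HahnK (PhaseTrop.surface f)) β ↔
            PhaseTrop.IsTropicalRoot f β)) ∧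
        ∀ α : ℝ, 0 < α →
          PhaseTrop.phaseTropLevel (PhaseTrop.surface f) α =
            PhaseTrop.zerosAt α
              {PhaseTrop.detPoly PhaseTrop.GrK, PhaseTrop.initPoly α f} \ {0} := by
  obtain ⟨P, hP, h⟩ := PhaseTrop.exists_generic U
  refine ⟨P, hP, fun f hfU hev hprime => ?_⟩
  have hg : PhaseTrop.IsGeneric f := by
    intro S hS
    rw [hfU] at hS
    exact h (fun u => (f.coeff u).leadingCoeff) hev S hS
  have hf : f ≠ 0 := by
    rw [← MvPolynomial.support_nonempty, hfU]
    exact hU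
  refine ⟨fun β hβ => ?_, fun α hα => ?_⟩
  · rw [PhaseTrop.vanishingIdeal_surface hprime]
    exact PhaseTrop.isCriticalLevel_iff hf hg hβ
  · obtain ⟨τ, hτ⟩ := PhaseTrop.exists_trop_eq hf α
    obtain ⟨f', hm⟩ := PhaseTrop.exists_model hf hτ
    exact PhaseTrop.phaseTropLevel_surface hα hm (hm.eval_one_ne_zero hf hτ hg)
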